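/- **Definitions.** Let $V$ be a seven-dimensional real vector space. A three-form $\varphi\in\Lambda^3V^*$ is a *$\mathrm G_2$-structure* if there is a basis $e_1,\dots,e_7$ of $V$ (an *adapted basis*) with $$\varphi=e^{127}+e^{347}+e^{567}+e^{135}-e^{146}-e^{236}-e^{245},$$ and a *$\mathrm G_2^*$-structure* if there is a basis $f_1,\dots,f_7$ of $V$ (an *adapted basis*) with $$\varphi=-f^{127}-f^{347}+f^{567}+f^{135}-f^{146}-f^{236}-f^{245}.$$ Here $e^1,\dots,e^7$ is the dual basis and $e^{ijk}=e^i\wedge e^j\wedge e^k$. Such a $\varphi$ induces a unique (pseudo-)Euclidean metric $g$ and volume form $\mathrm{vol}$ on $V$ with $$g(v,w)\,\mathrm{vol}=\tfrac16\,(v\lrcorner\varphi)\wedge(w\lrcorner\varphi)\wedge\varphi$$ such that every adapted basis is an oriented orthonormal basis; $g$ is positive definite for a $\mathrm G_2$-structure, while for a $\mathrm G_2^*$-structure the vectors $f_1,\dots,f_4$ of an adapted basis have square $-1$ and $f_5,f_6,f_7$ have square $1$. The Hodge dual $\star_\varphi\varphi\in\Lambda^4V^*$ is defined by $\varphi\wedge\Phi=g(\star_\varphi\varphi,\Phi)\,\mathrm{vol}$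 for all $\Phi\in\Lambda^4V^*$. If $V=\mathfrak g$ is a Lie algebra, $\varphi$ is called *cocalibrated* if $d\star_\varphi\varphi=0$, where $d$ is the exterior derivative on $\Lambda^*\mathfrak g^*$ determined by $(d\alpha)(X,Y)=-\alpha([X,Y])$ on one-forms. For a two-form $\omega$ on $U$, $\mathfrak{sp}(U,\omega)=\{f\in\mathfrak{gl}(U)\mid \omega(fx,y)+\omega(x,fy)=0\ \ \forall x,y\in U\}$. **Theorem.** Let $\mathfrak g$ be a seven-dimensional real Lie algebra with a six-dimensional Abelian ideal $\mathfrak u$. Let $e_7\in\mathfrak g\setminus\mathfrak u$, let $\omega_6\in\Lambda^2\mathfrak u^*$ be a non-degenerate two-form on $\mathfrak u$, let $V_4$ be a four-dimensional subspace of $\mathfrak u$, let $V_2$ be a two-dimensional subspace of $\mathfrak u$ complementary to $V_4$, and let $\omega_4\in\Lambda^2V_4^*$ be a non-degenerate two-form on $V_4$. Then: (a) The following three conditions are equivalent: $\mathfrak g$ admits a cocalibrated $\mathrm G_2$-structure; $\mathfrak g$ admits a cocalibrated $\mathrm G_2^*$-structure such that $\mathfrak u$ is a non-degenerate subspace of $\mathfrak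 g$ with respect to the induced pseudo-Euclidean metric on $\mathfrak g$; $\mathrm{ad}(e_7)|_{\mathfrak u}\in\mathfrak{gl}(\mathfrak u)$ is similar under $\mathrm{GL}(\mathfrak u)$ to an element of $\mathfrak{sp}(\mathfrak u,\omega_6)$. (b) $\mathfrak g$ admits a cocalibrated $\mathrm G_2^*$-structure if and only if $\mathrm{ad}(e_7)|_{\mathfrak u}$ is similar under $\mathrm{GL}(\mathfrak u)$ to an element of $\mathfrak{sp}(\mathfrak u,\omega_6)$ or to an element of $$\Bigl\{f\in\mathfrak{gl}(\mathfrak u)\Bigm| f|_{V_2}=f_2+h,\ f_2\in\mathfrak{gl}(V_2),\ h\in\mathrm{Hom}(V_2,V_4),\quad f|_{V_4}=-\tfrac{\mathrm{tr}(f_2)}2\,\mathrm{id}_{V_4}+f_4,\ f_4\in\mathfrak{sp}(V_4,\omega_4)\Bigr\}.$$ -/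

import Mathlib

/-- The exterior product `α₁ ∧ ⋯ ∧ α_k` of one-forms, i.e. the `k`-form
`(v₁, …, v_k) ↦ det (α_i (v_j))`. -/
def wedgeOneForms {V : Type*} [AddCommGroup V] [Module ℝ V] {k : ℕ}
    (α : Fin k → Module.Dual ℝ V) : V [⋀^Fin k]→ₗ[ℝ] ℝ :=
  (Matrix.detRowAlternating (n := Fin k) (R := ℝ)).compLinearMap (LinearMap.pi α)

/-- The exterior product of a `k`-form and an `l`-form: the signed sum over all
`(k, l)`-shuffles (so that `(α ∧ β) (v, w) = α v * β w - α w * β v` for one-forms). -/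
noncomputable def wedge {V : Type*} [AddCommGroup V] [Module ℝ V] {k l : ℕ}
    (α : V [⋀^Fin k]→ₗ[ℝ] ℝ) (β : V [⋀^Fin l]→ₗ[ℝ] ℝ) : V [⋀^Fin (k + l)]→ₗ[ℝ] ℝ :=
  ((LinearMap.mul' ℝ ℝ).compAlternatingMap (α.domCoprod β)).domDomCongr finSumFinEquiv

/-- For a basis `e₀, …, e₆` of `V` with dual basis `e⁰, …, e⁶`, the `k`-form
`e^{i₁} ∧ ⋯ ∧ e^{i_k}`. -/
noncomputable def basisForm {V : Type*} [AddCommGroup V] [Module ℝ V] {k : ℕ}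
    (e : Module.Basis (Fin 7) ℝ V) (i : Fin k → Fin 7) : V [⋀^Fin k]→ₗ[ℝ] ℝ :=
  wedgeOneForms fun a => e.coord (i a)

/-- The standard three-form
`e^{127} + e^{347} + e^{567} + e^{135} - e^{146} - e^{236} - e^{245}`
of a basis `e₁, …, e₇`; in the code the indices start at `0`. -/
noncomputable def standardG2Form {V : Type*} [AddCommGroup V] [Module ℝ V]
    (e : Module.Basis (Fin 7) ℝ V) : V [⋀^Fin 3]→ₗ[ℝ] ℝ :=
  basisForm e ![0, 1, 6] + basisForm e ![2, 3, 6] + basisForm e ![4, 5, 6]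
    + basisForm e ![0, 2, 4] - basisForm e ![0, 3, 5] - basisForm e ![1, 2, 5]
    - basisForm e ![1, 3, 4]

/-- The standard three-form
`- f^{127} - f^{347} + f^{567} + f^{135} - f^{146} - f^{236} - f^{245}`
of a basis `f₁, …, f₇`; in the code the indices start at `0`. -/
noncomputable def standardG2StarForm {V : Type*} [AddCommGroup V] [Module ℝ V]
    (f : Module.Basis (Fin 7) ℝ V) : V [⋀^Fin 3]→ₗ[ℝ] ℝ :=
  - basisForm f ![0, 1, 6] - basisForm f ![2, 3, 6] + basisForm f ![4, 5, 6]
    + basisForm f ![0, 2, 4] - basisForm f ![0, 3, 5] - basisForm f ![1, 2, 5]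
    - basisForm f ![1, 3, 4]

/-- `φ` is a `G₂`-structure on the (seven-dimensional) real vector space `V`. -/
def IsG2Structure {V : Type*} [AddCommGroup V] [Module ℝ V]
    (φ : V [⋀^Fin 3]→ₗ[ℝ] ℝ) : Prop :=
  ∃ e : Module.Basis (Fin 7) ℝ V, φ = standardG2Form e

/-- `φ` is a `G₂*`-structure on the (seven-dimensional) real vector space `V`. -/
def IsG2StarStructure {V : Type*} [AddCommGroup V] [Module ℝ V]
    (φ : V [⋀^Fin 3]→ₗ[ℝ] ℝ) : Prop :=
  ∃ f : Module.Basis (Fin 7) ℝ V, φ = standardG2StarForm f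

/-- The identity `g(v, w) vol = (1/6) (v ⌟ φ) ∧ (w ⌟ φ) ∧ φ` between a bilinear form `g`,
a seven-form `vol` and a three-form `φ`. -/
def MetricIdentity {V : Type*} [AddCommGroup V] [Module ℝ V]
    (φ : V [⋀^Fin 3]→ₗ[ℝ] ℝ) (g : LinearMap.BilinForm ℝ V) (vol : V [⋀^Fin 7]→ₗ[ℝ] ℝ) : Prop :=
  ∀ v w : V, g v w • vol = (1 / 6 : ℝ) • wedge (wedge (φ.curryLeft v) (φ.curryLeft w)) φ

/-- `g` and `vol` are the Euclidean metric and the volume form induced by the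
`G₂`-structure `φ`: the defining identity holds, and every adapted basis is an oriented
orthonormal basis. -/
def IsInducedByG2 {V : Type*} [AddCommGroup V] [Module ℝ V]
    (φ : V [⋀^Fin 3]→ₗ[ℝ] ℝ) (g : LinearMap.BilinForm ℝ V) (vol : V [⋀^Fin 7]→ₗ[ℝ] ℝ) : Prop :=
  MetricIdentity φ g vol ∧
    ∀ e : Module.Basis (Fin 7) ℝ V, φ = standardG2Form e →
      vol e = 1 ∧ ∀ i j, g (e i) (e j) = if i = j then 1 else 0

/-- `g` and `vol` are the pseudo-Euclidean metric and the volume form induced by the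
`G₂*`-structure `φ`: the defining identity holds, and every adapted basis is an oriented
orthonormal basis, whose first four vectors have square `-1` and whose last three vectors
have square `1`. -/
def IsInducedByG2Star {V : Type*} [AddCommGroup V] [Module ℝ V]
    (φ : V [⋀^Fin 3]→ₗ[ℝ] ℝ) (g : LinearMap.BilinForm ℝ V) (vol : V [⋀^Fin 7]→ₗ[ℝ] ℝ) : Prop :=
  MetricIdentity φ g vol ∧
    ∀ f : Module.Basis (Fin 7) ℝ V, φ = standardG2StarForm f →
      vol f = 1 ∧
        ∀ i j, g (f i) (f j) = if i = j then (if i < 4 then (-1) else 1) else 0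

/-- `Ψ` is the Hodge dual of the `k`-form `ψ` with respect to the (pseudo-)Euclidean metric `g`
and the volume form `vol`, that is `ψ ∧ Φ = g(Ψ, Φ) vol` for all `l`-forms `Φ`, where `k + l` is
the dimension.  The condition is imposed on the forms
`Φ = v₁♭ ∧ ⋯ ∧ v_l♭`, `v♭ = g(v, ·)`, which span all `l`-forms because `g` is non-degenerate, and
for which the induced metric on `l`-forms is `g(Ψ, Φ) = Ψ(v₁, …, v_l)`. -/
def IsHodgeDual {V : Type*} [AddCommGroup V] [Module ℝ V] {k l : ℕ}
    (g : LinearMap.BilinForm ℝ V) (vol : V [⋀^Fin (k + l)]→ₗ[ℝ] ℝ)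
    (ψ : V [⋀^Fin k]→ₗ[ℝ] ℝ) (Ψ : V [⋀^Fin l]→ₗ[ℝ] ℝ) : Prop :=
  ∀ v : Fin l → V, wedge ψ (wedgeOneForms fun a => g (v a)) = Ψ v • vol

/-- The exterior derivative of a `(k+1)`-form on a real Lie algebra (identified with a
left-invariant form), as a function of `k+2` arguments:
`(dω)(x₀, …, x_{k+1}) = ∑_{i<j} (-1)^{i+j} ω([x_i, x_j], x₀, …, x̂_i, …, x̂_j, …, x_{k+1})`.
In particular `(dα)(x, y) = -α([x, y])` for one-forms. -/
noncomputable def lieExtDeriv {L : Type*} [LieRing L] [LieAlgebra ℝ L] {k : ℕ}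
    (ω : L [⋀^Fin (k + 1)]→ₗ[ℝ] ℝ) (x : Fin (k + 2) → L) : ℝ :=
  ∑ j : Fin (k + 2), ∑ i : Fin (k + 1),
    if i.castSucc < j then
      (-1 : ℝ) ^ ((i : ℕ) + (j : ℕ)) *
        ω (Fin.cons ⁅x i.castSucc, x j⁆ fun m : Fin k => x (j.succAbove (i.succAbove m)))
    else 0

/-- A form on a real Lie algebra is closed if its exterior derivative vanishes. -/
def IsClosedForm {L : Type*} [LieRing L] [LieAlgebra ℝ L] {k : ℕ}
    (ω : L [⋀^Fin (k + 1)]→ₗ[ℝ] ℝ) : Prop :=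
  ∀ x : Fin (k + 2) → L, lieExtDeriv ω x = 0

/-- `φ` is a cocalibrated `G₂`-structure on the Lie algebra `L`: its Hodge dual with respect to
the metric and the volume form induced by `φ` is closed. -/
def IsCocalibratedG2 {L : Type*} [LieRing L] [LieAlgebra ℝ L]
    (φ : L [⋀^Fin 3]→ₗ[ℝ] ℝ) : Prop :=
  IsG2Structure φ ∧
    ∃ (g : LinearMap.BilinForm ℝ L) (vol : L [⋀^Fin 7]→ₗ[ℝ] ℝ) (Ψ : L [⋀^Fin 4]→ₗ[ℝ] ℝ),
      IsInducedByG2 φ g vol ∧ IsHodgeDual g vol φ Ψ ∧ IsClosedForm Ψ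

/-- `φ` is a cocalibrated `G₂*`-structure on the Lie algebra `L`: its Hodge dual with respect to
the metric and the volume form induced by `φ` is closed. -/
def IsCocalibratedG2Star {L : Type*} [LieRing L] [LieAlgebra ℝ L]
    (φ : L [⋀^Fin 3]→ₗ[ℝ] ℝ) : Prop :=
  IsG2StarStructure φ ∧
    ∃ (g : LinearMap.BilinForm ℝ L) (vol : L [⋀^Fin 7]→ₗ[ℝ] ℝ) (Ψ : L [⋀^Fin 4]→ₗ[ℝ] ℝ),
      IsInducedByG2Star φ g vol ∧ IsHodgeDual g vol φ Ψ ∧ IsClosedForm Ψ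

/-- The subspace `U` is non-degenerate with respect to the pseudo-Euclidean metric induced by the
`G₂*`-structure `φ`. -/
def IsNondegenerateForG2Star {V : Type*} [AddCommGroup V] [Module ℝ V]
    (φ : V [⋀^Fin 3]→ₗ[ℝ] ℝ) (U : Submodule ℝ V) : Prop :=
  ∃ (g : LinearMap.BilinForm ℝ V) (vol : V [⋀^Fin 7]→ₗ[ℝ] ℝ),
    IsInducedByG2Star φ g vol ∧ (g.restrict U).Nondegenerate

/-- The endomorphism `f` is similar under `GL(U)` to an element of `S`. -/
def IsSimilarToElementOf {U : Type*} [AddCommGroup U] [Module ℝ U]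
    (f : Module.End ℝ U) (S : Set (Module.End ℝ U)) : Prop :=
  ∃ T : U ≃ₗ[ℝ] U, T.conj f ∈ S

/-- The symplectic Lie algebra `sp(U, ω)`: all `f` with `ω(f x, y) + ω(x, f y) = 0`. -/
def symplecticAlgebra {U : Type*} [AddCommGroup U] [Module ℝ U]
    (ω : LinearMap.BilinForm ℝ U) : Set (Module.End ℝ U) :=
  {f | ∀ x y : U, ω (f x) y + ω x (f y) = 0}

/-- For a decomposition `U = V₂ ⊕ V₄` and a two-form `ω₄` on `V₄`, the set of all
endomorphisms `f` of `U` with `f|_{V₂} = f₂ + h` and `f|_{V₄} = - (tr f₂ / 2) id + f₄`, where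
`f₂ ∈ gl(V₂)`, `h ∈ Hom(V₂, V₄)` and `f₄ ∈ sp(V₄, ω₄)`. -/
def lengthTwoStabilizer {U : Type*} [AddCommGroup U] [Module ℝ U]
    (V₂ V₄ : Submodule ℝ U) (ω₄ : LinearMap.BilinForm ℝ V₄) : Set (Module.End ℝ U) :=
  {f | ∃ (f₂ : Module.End ℝ V₂) (h : V₂ →ₗ[ℝ] V₄) (f₄ : Module.End ℝ V₄),
    f₄ ∈ symplecticAlgebra ω₄ ∧
    (∀ x : V₂, f x = (f₂ x : U) + (h x : U)) ∧
    (∀ y : V₄, f y = (-(LinearMap.trace ℝ V₂ f₂ / 2)) • (y : U) + (f₄ y : U))}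

/-!
Let `n` be the normal vector of `𝔲` with `g(n, ·) = θ`, where `θ` vanishes on `𝔲` and `θ(e₇) = 1`.
Since `𝔲` is abelian, a four-form is closed if and only if its restriction to `𝔲` is annihilated by
the derivation induced by `ad(e₇)`. The restriction of `⋆φ` to `𝔲` is the contraction of a volume
form of `𝔲` with the bivector that is metrically dual to the two-form `n ⌟ φ`, so `φ` is
cocalibrated if and only if `ad(e₇)|_𝔲` rescales this bivector by its trace. The rank of `n ⌟ φ` is
six if `n` is non-null and four if `n` is null, which is impossible for a `G₂`-structure.
Bivectors of equal rank are equivalent under `GL(𝔲)`: the endomorphisms rescaling one of rank six by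
their trace form a symplectic algebra, and those rescaling one of rank four by their trace form the
second algebra of the theorem. Conversely, a frame of the model space in which `n₀ ⌟ φ` is in normal
form can be transported to `𝔤` in such a way that `n₀` becomes the normal of `𝔲`.
-/

section ExteriorProducts

/-- Evaluation of alternating maps at a fixed tuple of vectors, as a linear map. -/
def alternatingEval {R M N ι : Type*} [CommSemiring R] [AddCommMonoid M] [Module R M]
    [AddCommMonoid N] [Module R N] (v : ι → M) : (M [⋀^ι]→ₗ[R] N) →ₗ[R] N where
  toFun ω := ω v
  map_add' _ _ := rfl
  map_smul' _ _ := rfl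

theorem alternatingEval_apply {R M N ι : Type*} [CommSemiring R] [AddCommMonoid M] [Module R M]
    [AddCommMonoid N] [Module R N] (v : ι → M) (ω : M [⋀^ι]→ₗ[R] N) :
    alternatingEval v ω = ω v := rfl

theorem alternatingMap_sum_apply {R M N ι κ : Type*} [CommSemiring R] [AddCommMonoid M]
    [Module R M] [AddCommMonoid N] [Module R N] (s : Finset κ) (ω : κ → M [⋀^ι]→ₗ[R] N)
    (v : ι → M) : (∑ i ∈ s, ω i) v = ∑ i ∈ s, ω i v :=
  map_sum (alternatingEval v) ω s

variable {V : Type*} [AddCommGroup V] [Module ℝ V] {k l n : ℕ}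

theorem wedgeOneForms_apply (α : Fin k → Module.Dual ℝ V) (v : Fin k → V) :
    wedgeOneForms α v = (Matrix.of fun i j => α j (v i)).det := rfl

/-- The exterior product as a bilinear map. -/
noncomputable def wedgeₗ (k l : ℕ) :
    (V [⋀^Fin k]→ₗ[ℝ] ℝ) →ₗ[ℝ] (V [⋀^Fin l]→ₗ[ℝ] ℝ) →ₗ[ℝ] (V [⋀^Fin (k + l)]→ₗ[ℝ] ℝ) :=
  LinearMap.mk₂ ℝ wedge
    (fun _ _ _ => by
      ext; simp [wedge, ← AlternatingMap.domCoprod'_apply, TensorProduct.add_tmul])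
    (fun _ _ _ => by
      ext; simp [wedge, ← AlternatingMap.domCoprod'_apply, ← TensorProduct.smul_tmul'])
    (fun _ _ _ => by
      ext; simp [wedge, ← AlternatingMap.domCoprod'_apply, TensorProduct.tmul_add])
    (fun _ _ _ => by
      ext; simp [wedge, ← AlternatingMap.domCoprod'_apply])

theorem wedgeₗ_apply (α : V [⋀^Fin k]→ₗ[ℝ] ℝ) (β : V [⋀^Fin l]→ₗ[ℝ] ℝ) :
    wedgeₗ k l α β = wedge α β := rfl

theorem wedgeOneForms_eq_alternatization (α : Fin k → Module.Dual ℝ V) :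
    wedgeOneForms α = MultilinearMap.alternatization
      ((MultilinearMap.mkPiAlgebra ℝ (Fin k) ℝ).compLinearMap α) := by
  ext v
  rw [wedgeOneForms_apply, Matrix.det_apply, MultilinearMap.alternatization_apply]
  rfl

theorem wedge_wedgeOneForms (α : Fin k → Module.Dual ℝ V) (β : Fin l → Module.Dual ℝ V) :
    wedge (wedgeOneForms α) (wedgeOneForms β) = wedgeOneForms (Fin.append α β) := by
  rw [wedge, wedgeOneForms_eq_alternatization, wedgeOneForms_eq_alternatization,
    ← MultilinearMap.domCoprod_alternization]
  ext v
  rw [AlternatingMap.domDomCongr_apply, LinearMap.compAlternatingMap_apply,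
    MultilinearMap.alternatization_apply, map_sum, wedgeOneForms_apply, Matrix.det_apply,
    ← Equiv.sum_comp (Equiv.permCongr finSumFinEquiv)]
  refine Finset.sum_congr rfl fun σ _ => ?_
  rw [Equiv.Perm.sign_permCongr, map_zsmul_unit]
  congr 1
  rw [← Equiv.prod_comp finSumFinEquiv, Fintype.prod_sum_type]
  simp [MultilinearMap.domCoprod_apply]

theorem curryLeft_wedgeOneForms (α : Fin (k + 1) → Module.Dual ℝ V) (v : V) :
    (wedgeOneForms α).curryLeft v =
      ∑ p : Fin (k + 1), ((-1) ^ (p : ℕ) * α p v) • wedgeOneForms (α ∘ p.succAbove) := by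
  ext w
  rw [AlternatingMap.curryLeft_apply_apply, wedgeOneForms_apply, Matrix.det_succ_row_zero,
    alternatingMap_sum_apply]
  rfl

/-- The Levi-Civita symbol of a tuple of indices.  The sign of a permutation is spelled out as a
product, which the kernel evaluates much faster than `Equiv.Perm.sign`. -/
def leviCivita (f : Fin n → Fin n) : ℤ :=
  if f.Injective then ∏ i, ∏ j ∈ Finset.Ioi i, if f i < f j then 1 else -1 else 0

theorem leviCivita_perm (σ : Equiv.Perm (Fin n)) : leviCivita σ = σ.sign := by
  rw [leviCivita, if_pos σ.injective, Equiv.Perm.sign_eq_prod_prod_Ioi]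
  simp only [Units.coe_prod, apply_ite Units.val, Units.val_one, Units.val_neg]

theorem map_comp_eq_leviCivita_smul (ω : V [⋀^Fin n]→ₗ[ℝ] ℝ) (w : Fin n → V)
    (f : Fin n → Fin n) : ω (w ∘ f) = leviCivita f * ω w := by
  by_cases hf : f.Injective
  · obtain ⟨σ, rfl⟩ : ∃ σ : Equiv.Perm (Fin n), σ = f :=
      ⟨Equiv.ofBijective f (Finite.injective_iff_bijective.1 hf), rfl⟩
    rw [leviCivita_perm, ω.map_perm, Units.smul_def, zsmul_eq_mul]
  · obtain ⟨i, j, hfij, hne⟩ := Function.not_injective_iff.1 hf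
    rw [leviCivita, if_neg hf,
      ω.map_eq_zero_of_eq (w ∘ f) (congrArg w hfij) hne, Int.cast_zero, zero_mul]

theorem wedgeOneForms_coord_self (e : Module.Basis (Fin n) ℝ V) : wedgeOneForms e.coord e = 1 := by
  rw [wedgeOneForms_apply, ← Matrix.det_one (n := Fin n)]
  congr 1
  ext i j
  simp [Matrix.one_apply, Finsupp.single_apply]

theorem wedgeOneForms_coord_comp_self (e : Module.Basis (Fin n) ℝ V) (f : Fin n → Fin n) :
    wedgeOneForms (fun a => e.coord (f a)) e = leviCivita f := by
  have h := map_comp_eq_leviCivita_smul Matrix.detRowAlternating (Pi.basisFun ℝ (Fin n)) f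
  have h_one : Matrix.detRowAlternating (Pi.basisFun ℝ (Fin n)) = 1 := by
    rw [← Matrix.det_one (n := Fin n) (R := ℝ)]
    refine congrArg Matrix.detRowAlternating (funext₂ fun i j => ?_)
    simp [Pi.single_apply, Matrix.one_apply, eq_comm]
  rw [h_one, mul_one] at h
  rw [wedgeOneForms_apply, ← h, ← Matrix.det_transpose]
  refine congrArg Matrix.detRowAlternating (funext₂ fun i j => ?_)
  simp [Pi.single_apply, Finsupp.single_apply]

theorem alternatingMap_ext_of_basis (e : Module.Basis (Fin n) ℝ V)
    {ω η : V [⋀^Fin n]→ₗ[ℝ] ℝ} (h : ω e = η e) : ω = η := by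
  rw [ω.eq_smul_basis_det e, η.eq_smul_basis_det e, h]

end ExteriorProducts

section StandardForms

variable {V : Type*} [AddCommGroup V] [Module ℝ V] (δ : ℤˣ) (e : Module.Basis (Fin 7) ℝ V)

/-- The index triples of the terms of the standard three-forms. -/
def tripleIndex : Fin 7 → Fin 3 → Fin 7 :=
  ![![0, 1, 6], ![2, 3, 6], ![4, 5, 6], ![0, 2, 4], ![0, 3, 5], ![1, 2, 5], ![1, 3, 4]]

/-- The coefficients of the standard `G₂`-form (`δ = 1`) and of the standard `G₂*`-form
(`δ = -1`). -/
def tripleCoeff : Fin 7 → ℤ := ![δ, δ, 1, 1, -1, -1, -1]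

/-- The squares of the vectors of an adapted basis of a `G₂`-structure (`δ = 1`) or of a
`G₂*`-structure (`δ = -1`). -/
def metricSign : Fin 7 → ℤ := ![δ, δ, δ, δ, 1, 1, 1]

/-- The standard `G₂`-form (`δ = 1`) or `G₂*`-form (`δ = -1`) of a basis. -/
noncomputable def modelForm : V [⋀^Fin 3]→ₗ[ℝ] ℝ :=
  ∑ t, (tripleCoeff δ t : ℝ) • basisForm e (tripleIndex t)

/-- The metric for which the basis `e` is orthogonal, with squares `metricSign δ`. -/
noncomputable def modelMetric : LinearMap.BilinForm ℝ V :=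
  Matrix.toBilin e (Matrix.diagonal fun i => (metricSign δ i : ℝ))

/-- The volume form `e¹ ∧ ⋯ ∧ e⁷` of a basis. -/
noncomputable def basisVol : V [⋀^Fin 7]→ₗ[ℝ] ℝ := wedgeOneForms e.coord

theorem modelForm_one : modelForm 1 e = standardG2Form e := by
  simp only [modelForm, standardG2Form, Fin.sum_univ_seven, tripleCoeff, tripleIndex,
    Matrix.cons_val, Units.val_one, Int.cast_one, Int.cast_neg]
  module

theorem modelForm_neg_one : modelForm (-1) e = standardG2StarForm e := by
  simp only [modelForm, standardG2StarForm, Fin.sum_univ_seven, tripleCoeff, tripleIndex,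
    Matrix.cons_val, Units.val_one, Units.val_neg, Int.cast_one, Int.cast_neg]
  module

theorem modelMetric_apply_basis (i j : Fin 7) :
    modelMetric δ e (e i) (e j) = if i = j then (metricSign δ i : ℝ) else 0 := by
  rw [← LinearMap.BilinForm.toMatrix_apply, modelMetric, LinearMap.BilinForm.toMatrix_toBilin,
    Matrix.diagonal_apply]

theorem basisVol_self : basisVol e e = 1 := wedgeOneForms_coord_self e

theorem basisForm_self (I : Fin 7 → Fin 7) : basisForm e I e = leviCivita I :=
  wedgeOneForms_coord_comp_self e I

theorem wedge_basisForm {k l : ℕ} (I : Fin k → Fin 7) (J : Fin l → Fin 7) :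
    wedge (basisForm e I) (basisForm e J) = basisForm e (Fin.append I J) := by
  rw [basisForm, basisForm, wedge_wedgeOneForms, basisForm]
  congr 1
  ext a : 1
  refine Fin.addCases (fun i => ?_) (fun i => ?_) a <;> simp

theorem curryLeft_basisForm {k : ℕ} (I : Fin (k + 1) → Fin 7) (a : Fin 7) :
    (basisForm e I).curryLeft (e a) =
      ∑ p with I p = a, (-1 : ℝ) ^ (p : ℕ) • basisForm e (I ∘ p.succAbove) := by
  rw [basisForm, curryLeft_wedgeOneForms, Finset.sum_filter]
  refine Finset.sum_congr rfl fun p _ => ?_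
  rw [Module.Basis.coord_apply, Module.Basis.repr_self_apply, mul_ite, mul_one, mul_zero,
    ite_smul, zero_smul]
  exact if_congr eq_comm rfl rfl

theorem curryLeft_modelForm (a : Fin 7) :
    (modelForm δ e).curryLeft (e a) = ∑ t, ∑ p with tripleIndex t p = a,
      ((tripleCoeff δ t * (-1) ^ (p : ℕ) : ℤ) : ℝ) • basisForm e (tripleIndex t ∘ p.succAbove) := by
  have h : (modelForm δ e).curryLeft = ∑ t, (tripleCoeff δ t : ℝ) •
      (basisForm e (tripleIndex t)).curryLeft := by
    simp only [modelForm, ← AlternatingMap.curryLeftLinearMap_apply, map_sum, map_smul]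
  simp only [h, LinearMap.sum_apply, LinearMap.smul_apply, curryLeft_basisForm, Finset.smul_sum,
    smul_smul]
  push_cast
  rfl

/-- The coefficient of `(e_a ⌟ φ) ∧ (e_b ⌟ φ) ∧ φ` with respect to `e¹ ∧ ⋯ ∧ e⁷`, for the
standard three-form `φ` of `e`. -/
def metricCoeff (a b : Fin 7) : ℤ :=
  ∑ t'', tripleCoeff δ t'' * ∑ t', ∑ p' with tripleIndex t' p' = b,
    tripleCoeff δ t' * (-1) ^ (p' : ℕ) * ∑ t, ∑ p with tripleIndex t p = a,
      tripleCoeff δ t * (-1) ^ (p : ℕ) * leviCivita (n := 7)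
        (Fin.append (Fin.append (tripleIndex t ∘ p.succAbove) (tripleIndex t' ∘ p'.succAbove))
          (tripleIndex t''))

theorem metricCoeff_eq (a b : Fin 7) :
    metricCoeff δ a b = if a = b then 6 * metricSign δ a else 0 := by
  revert δ a b
  decide +kernel

theorem wedge_wedge_modelForm_self (a b : Fin 7) :
    wedge (wedge ((modelForm δ e).curryLeft (e a)) ((modelForm δ e).curryLeft (e b)))
      (modelForm δ e) e = metricCoeff δ a b := by
  have h (I : Fin (2 + 2 + 3) → Fin 7) : basisForm e I e = leviCivita (n := 7) I := by
    rw [← basisForm_self e]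
  rw [curryLeft_modelForm, curryLeft_modelForm]
  nth_rw 1 [modelForm]
  simp only [← wedgeₗ_apply, map_sum, LinearMap.sum_apply, map_smul, LinearMap.smul_apply]
  simp only [wedgeₗ_apply, wedge_basisForm, alternatingMap_sum_apply, AlternatingMap.smul_apply, h,
    smul_eq_mul, metricCoeff]
  push_cast
  rfl

end StandardForms

section InducedMetric

variable {V : Type*} [AddCommGroup V] [Module ℝ V] {δ : ℤˣ} {e e' : Module.Basis (Fin 7) ℝ V}

theorem metricIdentity_modelForm (δ : ℤˣ) (e : Module.Basis (Fin 7) ℝ V) :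
    MetricIdentity (modelForm δ e) (modelMetric δ e) (basisVol e) := by
  let Q : LinearMap.BilinForm ℝ V :=
    ((wedgeₗ 2 2).compl₁₂ (modelForm δ e).curryLeft (modelForm δ e).curryLeft).compr₂
      ((alternatingEval e).comp ((wedgeₗ (2 + 2) 3).flip (modelForm δ e)))
  have hQ_apply (v w : V) : Q v w =
      wedge (wedge ((modelForm δ e).curryLeft v) ((modelForm δ e).curryLeft w))
        (modelForm δ e) e := by
    simp only [Q, LinearMap.compr₂_apply, LinearMap.compl₁₂_apply, LinearMap.comp_apply,
      LinearMap.flip_apply, alternatingEval_apply, wedgeₗ_apply]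
  have hQ : Q = (6 : ℝ) • modelMetric δ e := by
    refine LinearMap.BilinForm.ext_basis e fun a b => ?_
    rw [hQ_apply, wedge_wedge_modelForm_self, LinearMap.smul_apply, LinearMap.smul_apply,
      modelMetric_apply_basis, metricCoeff_eq]
    split_ifs <;> simp
  refine fun v w => alternatingMap_ext_of_basis (n := 7) e ?_
  have hQvw : Q v w = 6 * modelMetric δ e v w := LinearMap.congr_fun₂ hQ v w
  rw [AlternatingMap.smul_apply, AlternatingMap.smul_apply, basisVol_self, ← hQ_apply, hQvw,
    smul_eq_mul, smul_eq_mul]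
  ring

theorem MetricIdentity.eq_smul {φ : V [⋀^Fin 3]→ₗ[ℝ] ℝ} {g g' : LinearMap.BilinForm ℝ V}
    {vol vol' : V [⋀^Fin 7]→ₗ[ℝ] ℝ} {c : ℝ} (h : MetricIdentity φ g vol)
    (h' : MetricIdentity φ g' vol') (h_ne : vol ≠ 0) (h_vol : vol' = c • vol) : g = c • g' := by
  ext v w
  have h_smul : g v w • vol = (c * g' v w) • vol := by
    rw [h v w, ← h' v w, h_vol, smul_smul, mul_comm]
  exact smul_left_injective ℝ h_ne h_smul

theorem det_toMatrix_eq_sq_mul {ι R M : Type*} [Fintype ι] [DecidableEq ι] [CommRing R]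
    [AddCommGroup M] [Module R M] (b b' : Module.Basis ι R M) (g : LinearMap.BilinForm R M) :
    (LinearMap.BilinForm.toMatrix b' g).det =
      (b.toMatrix b').det ^ 2 * (LinearMap.BilinForm.toMatrix b g).det := by
  rw [← LinearMap.BilinForm.toMatrix_mul_basis_toMatrix b b', Matrix.det_mul, Matrix.det_mul,
    Matrix.det_transpose]
  ring

theorem det_toMatrix_modelMetric (δ : ℤˣ) (e : Module.Basis (Fin 7) ℝ V) :
    (LinearMap.BilinForm.toMatrix e (modelMetric δ e)).det = 1 := by
  have h_prod : ∏ i, metricSign δ i = 1 := by revert δ; decide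
  rw [modelMetric, LinearMap.BilinForm.toMatrix_toBilin, Matrix.det_diagonal]
  exact_mod_cast h_prod

theorem basisVol_apply_basis (e e' : Module.Basis (Fin 7) ℝ V) :
    basisVol e e' = (e.toMatrix e').det := by
  rw [basisVol, wedgeOneForms_apply, ← Matrix.det_transpose]
  rfl

/-- Rescaling the volume form by `c` rescales the metric by `c⁻¹`, hence its Gram determinant by
`c⁻⁷`, while a change of basis of determinant `c⁻¹` rescales it by `c⁻²`; so `c ^ 9 = 1`. -/
theorem basisVol_eq_of_modelForm_eq (h : modelForm δ e = modelForm δ e') :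
    basisVol e = basisVol e' := by
  set c := basisVol e' e with hc_def
  have h_vol : basisVol e' = c • basisVol e :=
    alternatingMap_ext_of_basis e (by simp [c, basisVol_self])
  have h_metric : modelMetric δ e = c • modelMetric δ e' := by
    refine (metricIdentity_modelForm δ e).eq_smul (h ▸ metricIdentity_modelForm δ e') ?_ h_vol
    exact fun h0 => by simpa [h0] using basisVol_self e
  have h_det : c ^ 2 * c ^ 7 = 1 := by
    have h_gram := det_toMatrix_eq_sq_mul e' e (modelMetric δ e)
    rw [det_toMatrix_modelMetric, h_metric, map_smul, Matrix.det_smul, det_toMatrix_modelMetric,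
      Fintype.card_fin, mul_one] at h_gram
    rw [h_gram, hc_def, basisVol_apply_basis]
  have hc : c = 1 := by
    refine (Odd.strictMono_pow (R := ℝ) (n := 9) (by decide)).injective ?_
    linear_combination h_det
  rw [h_vol, hc, one_smul]

theorem modelMetric_eq_of_modelForm_eq (h : modelForm δ e = modelForm δ e') :
    modelMetric δ e = modelMetric δ e' := by
  rw [← one_smul ℝ (modelMetric δ e')]
  refine (metricIdentity_modelForm δ e).eq_smul (h ▸ metricIdentity_modelForm δ e') ?_ ?_
  · exact fun h0 => by simpa [h0] using basisVol_self e
  · rw [one_smul, basisVol_eq_of_modelForm_eq h]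

/-- The metric and the volume form induced by a `G₂`-structure (`δ = 1`) or by a `G₂*`-structure
(`δ = -1`). -/
def IsInduced (δ : ℤˣ) (φ : V [⋀^Fin 3]→ₗ[ℝ] ℝ) (g : LinearMap.BilinForm ℝ V)
    (vol : V [⋀^Fin 7]→ₗ[ℝ] ℝ) : Prop :=
  MetricIdentity φ g vol ∧ ∀ e : Module.Basis (Fin 7) ℝ V, φ = modelForm δ e →
    vol e = 1 ∧ ∀ i j, g (e i) (e j) = if i = j then (metricSign δ i : ℝ) else 0

theorem isInducedByG2_iff {φ : V [⋀^Fin 3]→ₗ[ℝ] ℝ} {g : LinearMap.BilinForm ℝ V}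
    {vol : V [⋀^Fin 7]→ₗ[ℝ] ℝ} : IsInducedByG2 φ g vol ↔ IsInduced 1 φ g vol := by
  have h_sign : ∀ i, metricSign 1 i = 1 := by decide
  simp only [IsInducedByG2, IsInduced, modelForm_one, h_sign, Int.cast_one]

theorem isInducedByG2Star_iff {φ : V [⋀^Fin 3]→ₗ[ℝ] ℝ} {g : LinearMap.BilinForm ℝ V}
    {vol : V [⋀^Fin 7]→ₗ[ℝ] ℝ} : IsInducedByG2Star φ g vol ↔ IsInduced (-1) φ g vol := by
  have h_sign : ∀ i, metricSign (-1) i = if i < 4 then -1 else 1 := by decide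
  simp only [IsInducedByG2Star, IsInduced, modelForm_neg_one, h_sign, Int.cast_ite, Int.cast_one,
    Int.cast_neg]

theorem isInduced_modelForm_iff {g : LinearMap.BilinForm ℝ V} {vol : V [⋀^Fin 7]→ₗ[ℝ] ℝ} :
    IsInduced δ (modelForm δ e) g vol ↔ g = modelMetric δ e ∧ vol = basisVol e := by
  constructor
  · rintro ⟨-, h⟩
    obtain ⟨h_vol, h_metric⟩ := h e rfl
    exact ⟨LinearMap.BilinForm.ext_basis e fun i j => by rw [h_metric, modelMetric_apply_basis],
      alternatingMap_ext_of_basis e (by rw [h_vol, basisVol_self])⟩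
  · rintro ⟨rfl, rfl⟩
    refine ⟨metricIdentity_modelForm δ e, fun e' h => ?_⟩
    rw [basisVol_eq_of_modelForm_eq h, modelMetric_eq_of_modelForm_eq h]
    exact ⟨basisVol_self e', modelMetric_apply_basis δ e'⟩

end InducedMetric

section HodgeDual

variable {V : Type*} [AddCommGroup V] [Module ℝ V] {k l : ℕ} {g : LinearMap.BilinForm ℝ V}
  {vol : V [⋀^Fin (k + l)]→ₗ[ℝ] ℝ} {ψ : V [⋀^Fin k]→ₗ[ℝ] ℝ} {Ψ : V [⋀^Fin l]→ₗ[ℝ] ℝ}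

theorem wedgeOneForms_apply_eq_det_eval (α : Fin l → Module.Dual ℝ V) (v : Fin l → V) :
    wedgeOneForms α v =
      Matrix.detRowAlternating.compLinearMap
        (LinearMap.pi fun i => Module.Dual.eval ℝ V (v i)) α := by
  rw [wedgeOneForms_apply, ← Matrix.det_transpose]
  rfl

/-- The exterior product of `l` one-forms as an alternating function of these. -/
noncomputable def wedgeOneFormsAlternating (l : ℕ) :
    Module.Dual ℝ V [⋀^Fin l]→ₗ[ℝ] (V [⋀^Fin l]→ₗ[ℝ] ℝ) where
  toFun := wedgeOneForms
  map_update_add' α i a b := by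
    ext x
    simp only [AlternatingMap.add_apply, wedgeOneForms_apply_eq_det_eval]
    convert AlternatingMap.map_update_add _ α i a b
  map_update_smul' α i c a := by
    ext x
    simp only [AlternatingMap.smul_apply, wedgeOneForms_apply_eq_det_eval]
    convert AlternatingMap.map_update_smul _ α i c a
  map_eq_zero_of_eq' α i j hij hne := by
    ext x
    rw [wedgeOneForms_apply_eq_det_eval, AlternatingMap.map_eq_zero_of_eq _ α hij hne]
    rfl

theorem exists_isHodgeDual (g : LinearMap.BilinForm ℝ V) (ψ : V [⋀^Fin k]→ₗ[ℝ] ℝ)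
    (b : Module.Basis (Fin (k + l)) ℝ V) (h_vol : vol b = 1) :
    ∃ Ψ : V [⋀^Fin l]→ₗ[ℝ] ℝ, IsHodgeDual g vol ψ Ψ := by
  refine ⟨(((alternatingEval b).comp (wedgeₗ k l ψ)).compAlternatingMap
    (wedgeOneFormsAlternating l)).compLinearMap g, fun v => alternatingMap_ext_of_basis b ?_⟩
  rw [AlternatingMap.smul_apply, h_vol, smul_eq_mul, mul_one]
  rfl

theorem wedge_wedgeOneForms_apply_of_dual (α : Fin k → Module.Dual ℝ V)
    (β : Fin l → Module.Dual ℝ V) (w : Fin (k + l) → V)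
    (h_left : ∀ a b, β a (w (Fin.castAdd l b)) = 0)
    (h_right : ∀ a b, β a (w (Fin.natAdd k b)) = if a = b then 1 else 0) :
    wedge (wedgeOneForms α) (wedgeOneForms β) w =
      wedgeOneForms α fun b => w (Fin.castAdd l b) := by
  have h_blocks :
      (Matrix.of fun i j => (Fin.append α β j) (w i)).submatrix finSumFinEquiv finSumFinEquiv =
        Matrix.fromBlocks (Matrix.of fun i j => α j (w (Fin.castAdd l i))) 0
          (Matrix.of fun i j => α j (w (Fin.natAdd k i))) 1 := by
    ext (i | i) (j | j) <;> simp [h_left, h_right, Matrix.one_apply, eq_comm]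
  rw [wedge_wedgeOneForms, wedgeOneForms_apply, wedgeOneForms_apply,
    ← Matrix.det_submatrix_equiv_self finSumFinEquiv, h_blocks, Matrix.det_fromBlocks_zero₁₂,
    Matrix.det_one, mul_one]

theorem wedge_apply_of_dual (hψ : ψ ∈ Submodule.span ℝ (Set.range wedgeOneForms))
    (β : Fin l → Module.Dual ℝ V) (w : Fin (k + l) → V)
    (h_left : ∀ a b, β a (w (Fin.castAdd l b)) = 0)
    (h_right : ∀ a b, β a (w (Fin.natAdd k b)) = if a = b then 1 else 0) :
    wedge ψ (wedgeOneForms β) w = ψ fun b => w (Fin.castAdd l b) := by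
  rw [← wedgeₗ_apply]
  induction hψ using Submodule.span_induction with
  | mem _ h =>
    obtain ⟨α, rfl⟩ := h
    exact wedge_wedgeOneForms_apply_of_dual α β w h_left h_right
  | zero => simp
  | add _ _ _ _ h h' => rw [map_add, LinearMap.add_apply, AlternatingMap.add_apply, h, h',
      AlternatingMap.add_apply]
  | smul _ _ _ h => rw [map_smul, LinearMap.smul_apply, AlternatingMap.smul_apply, h,
      AlternatingMap.smul_apply]

theorem IsHodgeDual.apply_mul_vol (h : IsHodgeDual g vol ψ Ψ)
    (hψ : ψ ∈ Submodule.span ℝ (Set.range wedgeOneForms)) (v : Fin l → V) (w : Fin (k + l) → V)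
    (h_left : ∀ a b, g (v a) (w (Fin.castAdd l b)) = 0)
    (h_right : ∀ a b, g (v a) (w (Fin.natAdd k b)) = if a = b then 1 else 0) :
    Ψ v * vol w = ψ fun b => w (Fin.castAdd l b) := by
  rw [← wedge_apply_of_dual hψ (fun a => g (v a)) w h_left h_right, h,
    AlternatingMap.smul_apply, smul_eq_mul]

theorem modelForm_mem_span (δ : ℤˣ) (e : Module.Basis (Fin 7) ℝ V) :
    modelForm δ e ∈ Submodule.span ℝ (Set.range wedgeOneForms) :=
  Submodule.sum_mem _ fun _ _ => Submodule.smul_mem _ _ (Submodule.subset_span ⟨_, rfl⟩)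

theorem exists_isHodgeDual_modelForm (δ : ℤˣ) (e : Module.Basis (Fin 7) ℝ V) :
    ∃ Ψ : V [⋀^Fin 4]→ₗ[ℝ] ℝ,
      IsHodgeDual (k := 3) (l := 4) (modelMetric δ e) (basisVol e) (modelForm δ e) Ψ := by
  have h_vol : basisVol e e = 1 := basisVol_self e
  generalize basisVol e = vol at h_vol ⊢
  exact exists_isHodgeDual _ _ e h_vol

end HodgeDual

section FormDerivation

variable {R V : Type*} [CommRing R] [AddCommGroup V] [Module R V] {k : ℕ}

/-- The action of an endomorphism on alternating forms as a derivation of the exterior algebra: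
`(D · Ψ) (v₀, …, v_k) = ∑ᵢ Ψ (v₀, …, D vᵢ, …, v_k)`. -/
noncomputable def formDerivation (D : Module.End R V) :
    (V [⋀^Fin (k + 1)]→ₗ[R] R) →ₗ[R] V [⋀^Fin (k + 1)]→ₗ[R] R :=
  AlternatingMap.alternatizeUncurryFinLM ∘ₗ LinearMap.lcomp R _ D ∘ₗ
    AlternatingMap.curryLeftLinearMap

theorem formDerivation_apply (D : Module.End R V) (Ψ : V [⋀^Fin (k + 1)]→ₗ[R] R)
    (v : Fin (k + 1) → V) :
    formDerivation D Ψ v =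
      ∑ p : Fin (k + 1), (-1) ^ (p : ℕ) * Ψ (Fin.cons (D (v p)) (p.removeNth v)) := by
  change AlternatingMap.alternatizeUncurryFin (Ψ.curryLeft ∘ₗ D) v = _
  rw [AlternatingMap.alternatizeUncurryFin_apply]
  simp only [zsmul_eq_mul, Int.cast_pow, Int.cast_neg, Int.cast_one]
  rfl

theorem formDerivation_apply_update (D : Module.End R V) (Ψ : V [⋀^Fin (k + 1)]→ₗ[R] R)
    (v : Fin (k + 1) → V) :
    formDerivation D Ψ v = ∑ p : Fin (k + 1), Ψ (Function.update v p (D (v p))) := by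
  rw [formDerivation_apply]
  refine Finset.sum_congr rfl fun p _ => ?_
  rw [← Fin.insertNth_removeNth, AlternatingMap.map_insertNth, zsmul_eq_mul]
  push_cast
  rfl

end FormDerivation

section Closedness

theorem alternatizeUncurryFin_smulRight_eq_zero_iff {R V : Type*} [CommRing R] [AddCommGroup V]
    [Module R V] {k n : ℕ} {θ : Module.Dual R V} (b : Module.Basis (Fin (n + 1)) R V)
    (h_zero : θ (b 0) = 1) (h_succ : ∀ i : Fin n, θ (b i.succ) = 0) (η : V [⋀^Fin k]→ₗ[R] R) :
    AlternatingMap.alternatizeUncurryFin (θ.smulRight η) = 0 ↔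
      ∀ u : Fin k → V, (∀ i, θ (u i) = 0) → η u = 0 := by
  refine ⟨fun h u hu => ?_, fun h => ?_⟩
  · have h_cons := DFunLike.congr_fun h (Fin.cons (b 0) u)
    rw [AlternatingMap.alternatizeUncurryFin_apply, Fin.sum_univ_succ] at h_cons
    simpa [hu, h_zero] using h_cons
  · refine Module.Basis.ext_alternating b fun I hI => ?_
    rw [AlternatingMap.alternatizeUncurryFin_apply, AlternatingMap.zero_apply]
    refine Finset.sum_eq_zero fun p _ => ?_
    rw [LinearMap.smulRight_apply, AlternatingMap.smul_apply]
    by_cases hp : I p = 0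
    · rw [h, smul_zero, smul_zero]
      intro i
      obtain ⟨q, hq⟩ := Fin.exists_succ_eq.2 fun h_eq : I (p.succAbove i) = 0 =>
        Fin.succAbove_ne p i (hI (h_eq.trans hp.symm))
      exact (congrArg (θ ∘ b) hq).symm.trans (h_succ q)
    · obtain ⟨q, hq⟩ := Fin.exists_succ_eq.2 hp
      rw [← hq, h_succ, zero_smul, smul_zero]

variable {L : Type*} [LieRing L] [LieAlgebra ℝ L] {k : ℕ}

theorem lieExtDeriv_eq_sum_triangle (Ψ : L [⋀^Fin (k + 1)]→ₗ[ℝ] ℝ) (x : Fin (k + 2) → L) :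
    lieExtDeriv Ψ x = ∑ i : Fin (k + 1), ∑ j ≥ i, (-1 : ℝ) ^ ((i : ℕ) + (j + 1 : ℕ)) *
      Ψ (Fin.cons ⁅x i.castSucc, x j.succ⁆ (i.removeNth (j.succ.removeNth x))) := by
  rw [lieExtDeriv, Fin.sum_univ_succ]
  simp only [Fin.not_lt_zero, if_false, Finset.sum_const_zero, zero_add, Fin.castSucc_lt_succ_iff]
  rw [Finset.sum_comm]
  simp only [← Finset.sum_filter, Finset.filter_le_eq_Ici]
  rfl

theorem lieExtDeriv_eq_neg_alternatizeUncurryFin {D : Module.End ℝ L} {θ : Module.Dual ℝ L}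
    (h_bracket : ∀ x y : L, ⁅x, y⁆ = θ x • D y - θ y • D x) (Ψ : L [⋀^Fin (k + 1)]→ₗ[ℝ] ℝ)
    (x : Fin (k + 2) → L) :
    lieExtDeriv Ψ x =
      -AlternatingMap.alternatizeUncurryFin (θ.smulRight (formDerivation D Ψ)) x := by
  have h_split (a b : ℝ) (v w : L) (u : Fin k → L) :
      Ψ (Fin.cons (a • v - b • w) u) = a * Ψ (Fin.cons v u) - b * Ψ (Fin.cons w u) := by
    change Ψ.curryLeft _ _ = a * Ψ.curryLeft _ _ - b * Ψ.curryLeft _ _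
    rw [map_sub, map_smul, map_smul]
    rfl
  simp only [lieExtDeriv_eq_sum_triangle, h_bracket, h_split,
    AlternatingMap.alternatizeUncurryFin_apply, LinearMap.smulRight_apply,
    AlternatingMap.smul_apply, formDerivation_apply, smul_eq_mul, zsmul_eq_mul, Finset.mul_sum]
  rw [Fin.sum_sum_eq_sum_triangle_add, ← Finset.sum_neg_distrib]
  refine Finset.sum_congr rfl fun i _ => ?_
  rw [← Finset.sum_neg_distrib]
  refine Finset.sum_congr rfl fun j hj => ?_
  rw [Finset.mem_Ici] at hj
  have h_lower : i.castSucc.succAbove j = j.succ := by simp [Fin.succAbove_of_le_castSucc, hj]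
  have h_upper : j.succ.succAbove i = i.castSucc := by simp [Fin.succAbove_of_castSucc_lt, hj]
  have h_pred : j.predAbove i.castSucc = i := by simp [Fin.predAbove_of_le_castSucc, hj]
  rw [Fin.removeNth_removeNth_eq_swap x j i.castSucc, h_lower, h_pred]
  simp only [Fin.removeNth_apply, h_lower, h_upper, Fin.val_castSucc, Fin.val_succ]
  push_cast
  ring

theorem isClosedForm_iff_formDerivation_eq_zero {D : Module.End ℝ L} {θ : Module.Dual ℝ L}
    (h_bracket : ∀ x y : L, ⁅x, y⁆ = θ x • D y - θ y • D x) {n : ℕ}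
    (b : Module.Basis (Fin (n + 1)) ℝ L) (h_zero : θ (b 0) = 1)
    (h_succ : ∀ i : Fin n, θ (b i.succ) = 0) (Ψ : L [⋀^Fin (k + 1)]→ₗ[ℝ] ℝ) :
    IsClosedForm Ψ ↔
      ∀ u : Fin (k + 1) → L, (∀ i, θ (u i) = 0) → formDerivation D Ψ u = 0 := by
  rw [← alternatizeUncurryFin_smulRight_eq_zero_iff b h_zero h_succ, AlternatingMap.ext_iff]
  exact forall_congr' fun x => by
    rw [lieExtDeriv_eq_neg_alternatizeUncurryFin h_bracket, neg_eq_zero, AlternatingMap.zero_apply]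

end Closedness

section BivectorContraction

variable {R U : Type*} [CommRing R] [AddCommGroup U] [Module R U] {m n : ℕ}

theorem formDerivation_basis_det (v : Module.Basis (Fin (m + 1)) R U) (D : Module.End R U) :
    formDerivation D v.det = (LinearMap.toMatrix v v D).trace • v.det := by
  have h_self : formDerivation D v.det v = (LinearMap.toMatrix v v D).trace := by
    rw [formDerivation_apply_update, Matrix.trace]
    refine Finset.sum_congr rfl fun p _ => ?_
    conv_lhs => rw [← v.sum_repr (D (v p)), v.det.map_update_sum]
    rw [Fintype.sum_eq_single p fun q hq => ?_]
    · rw [v.det.map_update_smul, Function.update_eq_self, v.det_self, smul_eq_mul, mul_one,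
        Matrix.diag_apply, LinearMap.toMatrix_apply]
    · rw [v.det.map_update_smul, v.det.map_eq_zero_of_eq (i := p) (j := q) _ ?_ hq.symm, smul_zero]
      rw [Function.update_self, Function.update_of_ne hq]
  rw [AlternatingMap.eq_smul_basis_det v (formDerivation D v.det), h_self]

theorem curryLeft_formDerivation (D : Module.End R U) (Ω : U [⋀^Fin (n + 2)]→ₗ[R] R) (x : U) :
    formDerivation D (Ω.curryLeft x) = (formDerivation D Ω).curryLeft x - Ω.curryLeft (D x) := by
  ext u
  rw [AlternatingMap.sub_apply, AlternatingMap.curryLeft_apply_apply, formDerivation_apply_update,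
    formDerivation_apply_update, Fin.sum_univ_succ (n := n + 1)]
  simp only [AlternatingMap.curryLeft_apply_apply, Matrix.vecCons, Fin.cons_zero, Fin.cons_succ,
    Fin.update_cons_zero, Fin.cons_update, add_sub_cancel_left]

/-- The iterated contraction of a form with two vectors, as a bilinear map. -/
def doubleContraction (Ω : U [⋀^Fin (n + 2)]→ₗ[R] R) : U →ₗ[R] U →ₗ[R] U [⋀^Fin n]→ₗ[R] R :=
  AlternatingMap.curryLeftLinearMap ∘ₗ Ω.curryLeft

theorem doubleContraction_apply (Ω : U [⋀^Fin (n + 2)]→ₗ[R] R) (x y : U) :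
    doubleContraction Ω x y = (Ω.curryLeft x).curryLeft y := rfl

theorem formDerivation_doubleContraction (D : Module.End R U) (Ω : U [⋀^Fin (n + 3)]→ₗ[R] R)
    (x y : U) :
    formDerivation D (doubleContraction Ω x y) =
      doubleContraction (formDerivation D Ω) x y - doubleContraction Ω (D x) y -
        doubleContraction Ω x (D y) := by
  rw [doubleContraction_apply, curryLeft_formDerivation, curryLeft_formDerivation,
    ← AlternatingMap.curryLeftLinearMap_apply, map_sub]
  rfl

/-- The contraction of the volume form of a basis with a bivector, given by its matrix `B` of
coefficients with respect to that basis. -/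
noncomputable def contractBivector (v : Module.Basis (Fin (n + 2)) R U) :
    Matrix (Fin (n + 2)) (Fin (n + 2)) R →ₗ[R] U [⋀^Fin n]→ₗ[R] R where
  toFun B := ∑ i, ∑ j, B i j • doubleContraction v.det (v i) (v j)
  map_add' B C := by simp only [Matrix.add_apply, add_smul, Finset.sum_add_distrib]
  map_smul' c B := by
    simp only [Matrix.smul_apply, smul_assoc, Finset.smul_sum, RingHom.id_apply]

theorem contractBivector_apply (v : Module.Basis (Fin (n + 2)) R U)
    (B : Matrix (Fin (n + 2)) (Fin (n + 2)) R) :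
    contractBivector v B = ∑ i, ∑ j, B i j • doubleContraction v.det (v i) (v j) := rfl

theorem contractBivector_toMatrix_mul (v : Module.Basis (Fin (n + 2)) R U) (D : Module.End R U)
    (B : Matrix (Fin (n + 2)) (Fin (n + 2)) R) :
    contractBivector v (LinearMap.toMatrix v v D * B) =
      ∑ i, ∑ j, B i j • doubleContraction v.det (D (v i)) (v j) := by
  have h_apply (i : Fin (n + 2)) : D (v i) = ∑ q, LinearMap.toMatrix v v D q i • v q := by
    simp only [LinearMap.toMatrix_apply, v.sum_repr]
  simp only [contractBivector_apply, h_apply, Matrix.mul_apply, map_sum, map_smul,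
    LinearMap.sum_apply, LinearMap.smul_apply, Finset.smul_sum, Finset.sum_smul, smul_smul]
  rw [Finset.sum_comm]
  conv_rhs => rw [Finset.sum_comm]
  refine Finset.sum_congr rfl fun j _ => ?_
  rw [Finset.sum_comm]
  simp only [mul_comm]

theorem contractBivector_mul_transpose_toMatrix (v : Module.Basis (Fin (n + 2)) R U)
    (D : Module.End R U) (B : Matrix (Fin (n + 2)) (Fin (n + 2)) R) :
    contractBivector v (B * (LinearMap.toMatrix v v D).transpose) =
      ∑ i, ∑ j, B i j • doubleContraction v.det (v i) (D (v j)) := by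
  have h_apply (i : Fin (n + 2)) : D (v i) = ∑ q, LinearMap.toMatrix v v D q i • v q := by
    simp only [LinearMap.toMatrix_apply, v.sum_repr]
  simp only [contractBivector_apply, h_apply, Matrix.mul_apply, Matrix.transpose_apply, map_sum,
    map_smul, Finset.smul_sum, Finset.sum_smul, smul_smul]
  refine Finset.sum_congr rfl fun i _ => ?_
  rw [Finset.sum_comm]

theorem formDerivation_contractBivector (v : Module.Basis (Fin (n + 3)) R U) (D : Module.End R U)
    (B : Matrix (Fin (n + 3)) (Fin (n + 3)) R) :
    formDerivation D (contractBivector v B) =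
      contractBivector v ((LinearMap.toMatrix v v D).trace • B - LinearMap.toMatrix v v D * B -
        B * (LinearMap.toMatrix v v D).transpose) := by
  rw [map_sub, map_sub, map_smul, contractBivector_toMatrix_mul,
    contractBivector_mul_transpose_toMatrix, contractBivector_apply]
  simp only [map_sum, map_smul, formDerivation_doubleContraction, formDerivation_basis_det,
    Finset.smul_sum, ← Finset.sum_sub_distrib]
  refine Finset.sum_congr rfl fun i _ => Finset.sum_congr rfl fun j _ => ?_
  have h_smul (c : R) (Ω : U [⋀^Fin (n + 3)]→ₗ[R] R) (x y : U) :
      doubleContraction (c • Ω) x y = c • doubleContraction Ω x y := rfl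
  rw [h_smul, smul_sub, smul_sub, smul_comm]

theorem doubleContraction_isAlt (Ω : U [⋀^Fin (n + 2)]→ₗ[R] R) :
    (doubleContraction Ω).IsAlt :=
  Ω.curryLeft_same

theorem doubleContraction_apply_mem_right (Ω : U [⋀^Fin (n + 2)]→ₗ[R] R) (x : U) (u : Fin n → U)
    (r : Fin n) : doubleContraction Ω x (u r) u = 0 :=
  Ω.map_eq_zero_of_eq (i := 1) (j := r.succ.succ) _ rfl
    fun h => (Fin.succ_ne_zero r (Fin.succ_injective _ h.symm))

theorem doubleContraction_apply_mem_left (Ω : U [⋀^Fin (n + 2)]→ₗ[R] R) (x : U) (u : Fin n → U)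
    (r : Fin n) : doubleContraction Ω (u r) x u = 0 := by
  rw [← (doubleContraction_isAlt Ω).neg, AlternatingMap.neg_apply,
    doubleContraction_apply_mem_right, neg_zero]

theorem contractBivector_apply_perm (v : Module.Basis (Fin (n + 2)) R U)
    (B : Matrix (Fin (n + 2)) (Fin (n + 2)) R) (τ : Equiv.Perm (Fin (n + 2))) :
    contractBivector v B (fun r => v (τ r.succ.succ)) =
      ((τ.sign : ℤ) : R) * (B (τ 0) (τ 1) - B (τ 1) (τ 0)) := by
  set u : Fin n → U := fun r => v (τ r.succ.succ)
  have h_sign : doubleContraction v.det (v (τ 0)) (v (τ 1)) u = ((τ.sign : ℤ) : R) := by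
    have h_perm : v.det (v ∘ τ) = ((τ.sign : ℤ) : R) := by
      rw [v.det.map_perm, v.det_self, Units.smul_def, zsmul_one]
    rw [← h_perm]
    refine congrArg v.det (funext (Fin.cases rfl (Fin.cases rfl fun r => rfl)))
  have h_swap : doubleContraction v.det (v (τ 1)) (v (τ 0)) u = -((τ.sign : ℤ) : R) := by
    rw [← h_sign, ← AlternatingMap.neg_apply, (doubleContraction_isAlt v.det).neg]
  have h_left (r : Fin n) (x : U) : doubleContraction v.det (v (τ r.succ.succ)) x u = 0 :=
    doubleContraction_apply_mem_left v.det x u r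
  have h_right (r : Fin n) (x : U) : doubleContraction v.det x (v (τ r.succ.succ)) u = 0 :=
    doubleContraction_apply_mem_right v.det x u r
  have h_sum : contractBivector v B u =
      ∑ p, ∑ q, B (τ p) (τ q) * doubleContraction v.det (v (τ p)) (v (τ q)) u := by
    simp only [contractBivector_apply, alternatingMap_sum_apply, AlternatingMap.smul_apply,
      smul_eq_mul]
    rw [← Equiv.sum_comp τ]
    exact Finset.sum_congr rfl fun p _ => (Equiv.sum_comp τ _).symm
  simp only [h_sum, Fin.sum_univ_succ, Fin.succ_zero_eq_one, h_left, h_right,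
    doubleContraction_isAlt v.det _, AlternatingMap.zero_apply, h_sign, h_swap, mul_zero,
    Finset.sum_const_zero, add_zero, zero_add]
  ring

theorem exists_perm_zero_one {i j : Fin (n + 2)} (hij : i ≠ j) :
    ∃ τ : Equiv.Perm (Fin (n + 2)), τ 0 = i ∧ τ 1 = j := by
  obtain ⟨τ, hτ⟩ := Equiv.Perm.exists_extending_pair ![(0 : Fin (n + 2)), 1] ![i, j]
    (by simp [Function.Injective, Fin.forall_fin_two])
    (by simp [Function.Injective, Fin.forall_fin_two, hij, hij.symm])
  exact ⟨τ, hτ 0, hτ 1⟩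

theorem exists_perm_succ_succ {I : Fin n → Fin (n + 2)} (hI : I.Injective) :
    ∃ τ : Equiv.Perm (Fin (n + 2)), I = fun r => τ r.succ.succ := by
  obtain ⟨τ, hτ⟩ := Equiv.Perm.exists_extending_pair (fun r : Fin n => r.succ.succ) I
    ((Fin.succ_injective _).comp (Fin.succ_injective _)) hI
  exact ⟨τ, funext fun r => (hτ r).symm⟩

theorem contractBivector_eq_zero_iff [IsDomain R] [NeZero (2 : R)]
    (v : Module.Basis (Fin (n + 2)) R U) {B : Matrix (Fin (n + 2)) (Fin (n + 2)) R}
    (hB : B.transpose = -B) : contractBivector v B = 0 ↔ B = 0 := by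
  have h_skew (i j : Fin (n + 2)) : B j i = -B i j := congrFun (congrFun hB i) j
  refine ⟨fun h => ?_, fun h => by rw [h, map_zero]⟩
  ext i j
  rw [Matrix.zero_apply]
  refine (mul_eq_zero.1 (?_ : (2 : R) * B i j = 0)).resolve_left two_ne_zero
  by_cases hij : i = j
  · subst hij
    linear_combination h_skew i i
  obtain ⟨τ, rfl, rfl⟩ := exists_perm_zero_one hij
  have h_apply := contractBivector_apply_perm v B τ
  rw [h, AlternatingMap.zero_apply, h_skew (τ 0) (τ 1), sub_neg_eq_add, ← two_mul,
    eq_comm] at h_apply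
  exact (τ.sign.isUnit.map (Int.castRingHom R)).mul_right_eq_zero.1 h_apply

theorem two_smul_eq_contractBivector {v : Module.Basis (Fin (n + 2)) R U}
    {B : Matrix (Fin (n + 2)) (Fin (n + 2)) R} (hB : B.transpose = -B)
    {Ψ : U [⋀^Fin n]→ₗ[R] R}
    (h : ∀ τ : Equiv.Perm (Fin (n + 2)),
      Ψ (fun r => v (τ r.succ.succ)) = ((τ.sign : ℤ) : R) * B (τ 0) (τ 1)) :
    (2 : R) • Ψ = contractBivector v B := by
  refine Module.Basis.ext_alternating v fun I hI => ?_
  obtain ⟨τ, rfl⟩ := exists_perm_succ_succ hI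
  have h_skew : B (τ 1) (τ 0) = -B (τ 0) (τ 1) := congrFun (congrFun hB (τ 0)) (τ 1)
  rw [contractBivector_apply_perm, h_skew, AlternatingMap.smul_apply, h, smul_eq_mul]
  ring

/-- Let `a` be the matrix of an endomorphism `A`; the condition says that the infinitesimal
action of `A` on bivectors rescales the bivector with coefficient matrix `B` by the trace
of `A`. -/
def RescalesByTrace {ι : Type*} [Fintype ι] (a B : Matrix ι ι R) : Prop :=
  a * B + B * a.transpose = a.trace • B

theorem formDerivation_contractBivector_eq_zero_iff [IsDomain R] [NeZero (2 : R)]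
    (v : Module.Basis (Fin (n + 3)) R U) {B : Matrix (Fin (n + 3)) (Fin (n + 3)) R}
    (hB : B.transpose = -B) (A : Module.End R U) :
    formDerivation A (contractBivector v B) = 0 ↔
      RescalesByTrace (LinearMap.toMatrix v v A) B := by
  rw [formDerivation_contractBivector, contractBivector_eq_zero_iff, sub_sub, sub_eq_zero, eq_comm,
    RescalesByTrace]
  simp only [Matrix.transpose_sub, Matrix.transpose_smul, Matrix.transpose_mul,
    Matrix.transpose_transpose, hB, Matrix.neg_mul, Matrix.mul_neg, smul_neg]
  abel

end BivectorContraction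

section AlternatingNormalForm

/-- The Gram matrix, with entries indexed by natural numbers, of the alternating form of
rank `2 * k` on vectors `x₀, y₀, x₁, y₁, …` with `⟨x_i, y_i⟩ = 1` for `i < k` in which all other
products of an `x` and a `y`, or of two `x` or two `y`, vanish. -/
def standardSkew : ℕ → ℕ → ℕ → ℤ
  | _ + 1, 0, 1 => 1
  | _ + 1, 1, 0 => -1
  | k + 1, i + 2, j + 2 => standardSkew k i j
  | _, _, _ => 0

theorem standardSkew_swap (k i j : ℕ) : standardSkew k j i = -standardSkew k i j := by
  induction k generalizing i j with
  | zero => simp [standardSkew]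
  | succ k ih =>
    match i, j with
    | i + 2, j + 2 => exact ih i j
    | 0, 0 | 0, 1 | 1, 0 | 1, 1 | 0, _ + 2 | 1, _ + 2 | _ + 2, 0 | _ + 2, 1 => rfl

theorem standardSkew_eq_zero {k i : ℕ} (hi : 2 * k ≤ i) (j : ℕ) : standardSkew k i j = 0 := by
  induction k generalizing i j with
  | zero => rfl
  | succ k ih =>
    obtain ⟨i, rfl⟩ : ∃ i', i = i' + 2 := ⟨i - 2, by lia⟩
    rcases j with _ | _ | j <;> simp [standardSkew, ih (i := i) (by lia)]

variable {K V : Type*} [Field K] [AddCommGroup V] [Module K V] {B : LinearMap.BilinForm K V}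

theorem exists_apply_eq_one (hB : B ≠ 0) : ∃ x y, B x y = 1 := by
  contrapose! hB
  refine LinearMap.ext₂ fun x y => ?_
  by_contra hxy
  exact hB x ((B x y)⁻¹ • y) (by rw [map_smul, smul_eq_mul, inv_mul_cancel₀ hxy])

theorem exists_basis_of_hyperbolicPair (hB : B.IsAlt) {x y : V} (hxy : B x y = 1) {m : ℕ}
    (c : Module.Basis (Fin m) K ↥(LinearMap.ker (B x) ⊓ LinearMap.ker (B y))) :
    ∃ b : Module.Basis (Fin (m + 2)) K V, b 0 = x ∧ b 1 = y ∧ ∀ i, b i.succ.succ = c i := by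
  have hyx : B y x = -1 := by rw [← hB.neg_eq, hxy]
  let b' : Module.Basis (Fin (m + 1)) K (LinearMap.ker (B y)) :=
    Module.Basis.mkFinConsOfLE y (hB y) c inf_le_right
      (fun a z hz h => by
        simpa [hxy, LinearMap.mem_ker.1 hz.1] using congrArg (B x) h)
      (fun z hz => ⟨-B x z, by simpa [hxy, hB y] using hz⟩)
  let b : Module.Basis (Fin (m + 2)) K V :=
    Module.Basis.mkFinCons x b'
      (fun a z hz h => by simpa [hyx, LinearMap.mem_ker.1 hz] using congrArg (B y) h)
      (fun z => ⟨B y z, by simp [hyx]⟩)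
  have hb : ⇑b = Fin.cons x ((↑) ∘ b') := Module.Basis.coe_mkFinCons ..
  have hb' : ⇑b' = Fin.cons ⟨y, hB y⟩ (Submodule.inclusion inf_le_right ∘ c) :=
    Module.Basis.coe_mkFinConsOfLE ..
  refine ⟨b, ?_, ?_, fun i => ?_⟩
  · rw [hb, Fin.cons_zero]
  · rw [hb, ← Fin.succ_zero_eq_one, Fin.cons_succ, Function.comp_apply, hb', Fin.cons_zero]
  · rw [hb, Fin.cons_succ, Function.comp_apply, hb', Fin.cons_succ]
    rfl

theorem exists_basis_apply_eq_standardSkew [FiniteDimensional K V] {d : ℕ}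
    (hd : Module.finrank K V = d) (hB : B.IsAlt) :
    ∃ k, 2 * k ≤ d ∧ ∃ b : Module.Basis (Fin d) K V,
      ∀ i j, B (b i) (b j) = (standardSkew k i j : K) := by
  induction d using Nat.strong_induction_on generalizing V with
  | _ d ih =>
  rcases eq_or_ne B 0 with rfl | h_ne
  · exact ⟨0, d.zero_le, Module.finBasisOfFinrankEq K V hd, fun i j => by simp [standardSkew]⟩
  obtain ⟨x, y, hxy⟩ := exists_apply_eq_one h_ne
  let W : Submodule K V := LinearMap.ker (B x) ⊓ LinearMap.ker (B y)
  obtain ⟨m, hm⟩ : ∃ m, Module.finrank K W = m := ⟨_, rfl⟩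
  obtain rfl : d = m + 2 := by
    obtain ⟨b, -⟩ := exists_basis_of_hyperbolicPair hB hxy (Module.finBasisOfFinrankEq K W hm)
    rw [← hd, Module.finrank_eq_card_basis b, Fintype.card_fin]
  obtain ⟨k, hk, c, hc⟩ := ih m (by lia) hm (B := B.restrict W) fun z => hB z
  obtain ⟨b, hb_zero, hb_one, hb⟩ := exists_basis_of_hyperbolicPair hB hxy c
  have hx (i : Fin m) : B x (c i) = 0 := (c i).2.1
  have hy (i : Fin m) : B y (c i) = 0 := (c i).2.2
  have hx' (i : Fin m) : B (c i) x = 0 := by rw [← hB.neg_eq, hx, neg_zero]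
  have hy' (i : Fin m) : B (c i) y = 0 := by rw [← hB.neg_eq, hy, neg_zero]
  have hyx : B y x = -1 := by rw [← hB.neg_eq, hxy]
  have hc (i j : Fin m) : B (c i) (c j) = standardSkew k i j := hc i j
  refine ⟨k + 1, by lia, b, ?_⟩
  simp [Fin.forall_fin_succ, hb_zero, hb_one, hb, hxy, hyx, hx, hy, hx', hy', hB x, hB y, hc,
    standardSkew]

theorem exists_basis_cons_apply_eq_standardSkew [FiniteDimensional K V] {d : ℕ}
    (hd : Module.finrank K V = d + 1) (hB : B.IsAlt) {n : V} (h_ne : n ≠ 0) :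
    ∃ k, 2 * k ≤ d ∧ ∃ w : Module.Basis (Fin (d + 1)) K V, w 0 = n ∧
      ∀ i j : Fin d, B (w i.succ) (w j.succ) = (standardSkew k i j : K) := by
  obtain ⟨W, hW⟩ := (K ∙ n).exists_isCompl
  have h_finrank : Module.finrank K W = d := by
    have h_add := Submodule.finrank_add_eq_of_isCompl hW
    rw [finrank_span_singleton h_ne, hd] at h_add
    lia
  obtain ⟨k, hk, c, hc⟩ := exists_basis_apply_eq_standardSkew h_finrank (B := B.restrict W)
    fun z => hB z
  have h_indep (a : K) (x : V) (hx : x ∈ W) (h : a • n + x = 0) : a = 0 := by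
    have h_mem : a • n ∈ W := by
      rw [eq_neg_of_add_eq_zero_left h]
      exact W.neg_mem hx
    have h_zero := Submodule.disjoint_def.1 hW.disjoint _
      (Submodule.smul_mem _ a (Submodule.mem_span_singleton_self n)) h_mem
    exact (smul_eq_zero.1 h_zero).resolve_right h_ne
  have h_span (z : V) : ∃ a : K, z + a • n ∈ W := by
    obtain ⟨_, hy, x, hx, rfl⟩ := Submodule.mem_sup.1 (hW.sup_eq_top ▸ Submodule.mem_top (x := z))
    obtain ⟨a, rfl⟩ := Submodule.mem_span_singleton.1 hy
    exact ⟨-a, by simpa⟩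
  refine ⟨k, hk, Module.Basis.mkFinCons n c h_indep h_span, ?_, fun i j => ?_⟩
  · rw [Module.Basis.coe_mkFinCons, Fin.cons_zero]
  · rw [Module.Basis.coe_mkFinCons, Fin.cons_succ, Fin.cons_succ]
    exact hc i j

theorem card_le_finrank_ker [FiniteDimensional K V] {ι W : Type*} [AddCommGroup W] [Module K W]
    (b : Module.Basis ι K V) (f : V →ₗ[K] W) (s : Finset ι) (hs : ∀ i ∈ s, f (b i) = 0) :
    s.card ≤ Module.finrank K (LinearMap.ker f) := by
  have h_indep : LinearIndependent K fun i : s => (⟨b i, hs i i.2⟩ : LinearMap.ker f) :=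
    LinearIndependent.of_comp (LinearMap.ker f).subtype
      (b.linearIndependent.comp _ Subtype.val_injective)
  simpa using h_indep.fintype_card_le_finrank

end AlternatingNormalForm

section StabilizerAlgebras

/-- The matrix of the standard alternating form of rank `2 * k` on a space of dimension `d`. -/
def skewMatrix (R : Type*) [Ring R] (d k : ℕ) : Matrix (Fin d) (Fin d) R :=
  Matrix.of fun i j => (standardSkew k i j : R)

theorem skewMatrix_mul_self (R : Type*) [Ring R] (k : ℕ) :
    skewMatrix R (2 * k) k * skewMatrix R (2 * k) k = -1 := by
  have h_sum (i j : Fin (2 * k)) :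
      ∑ m : Fin (2 * k), standardSkew k i m * standardSkew k m j = if i = j then -1 else 0 := by
    induction k with
    | zero => exact i.elim0
    | succ k ih =>
      revert i j
      change ∀ i j : Fin (2 * k + 1 + 1), ∑ m : Fin (2 * k + 1 + 1), _ = _
      simp only [Fin.forall_fin_succ, Fin.sum_univ_succ, Fin.succ_inj, Fin.val_succ,
        standardSkew, ih]
      simp [standardSkew, (Fin.succ_ne_zero _).symm]
  ext i j
  simp only [skewMatrix, Matrix.mul_apply, Matrix.of_apply, ← Int.cast_mul, ← Int.cast_sum, h_sum]
  split_ifs with hij <;> simp [hij]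

theorem transpose_skewMatrix (R : Type*) [Ring R] (d k : ℕ) :
    (skewMatrix R d k).transpose = -skewMatrix R d k := by
  ext i j
  simp [skewMatrix, standardSkew_swap k i j]

section

variable {K ι : Type*} [Field K] [Fintype ι] [DecidableEq ι] {a J : Matrix ι ι K}

theorem mul_add_mul_transpose_eq_smul_iff (hJ : J * J = -1) (s : K) :
    a * J + J * a.transpose = s • J ↔ a.transpose * J + J * a = s • J := by
  have h_conj {b c : Matrix ι ι K} (h : b * J + J * c = s • J) : c * J + J * b = s • J := by
    have h_mul : J * (b * J + J * c) * J = J * (s • J) * J := by rw [h]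
    have h_left : J * (b * J + J * c) * J = -(c * J + J * b) := by
      calc J * (b * J + J * c) * J = J * b * (J * J) + (J * J) * c * J := by noncomm_ring
        _ = -(c * J + J * b) := by rw [hJ]; noncomm_ring
    rw [h_left, Matrix.mul_smul, Matrix.smul_mul, hJ, neg_one_mul, smul_neg] at h_mul
    exact neg_injective h_mul
  exact ⟨h_conj, h_conj⟩

theorem two_mul_trace_eq (hJ : J * J = -1) {s : K} (h : a.transpose * J + J * a = s • J) :
    2 * a.trace = s * Fintype.card ι := by
  have h_trace : ((a.transpose * J + J * a) * J).trace = -(2 * a.trace) := by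
    rw [Matrix.add_mul, Matrix.trace_add, Matrix.mul_assoc, hJ, Matrix.trace_mul_comm (J * a),
      ← Matrix.mul_assoc, hJ]
    simp only [mul_neg, mul_one, neg_mul, one_mul, Matrix.trace_neg, Matrix.trace_transpose]
    ring
  rw [h, Matrix.smul_mul, hJ] at h_trace
  simpa using h_trace.symm

theorem transpose_add_smul_one_mul_add_eq_zero_iff (t : K) :
    (a + t • 1).transpose * J + J * (a + t • 1) = 0 ↔ a.transpose * J + J * a = (-(2 * t)) • J := by
  rw [← sub_eq_zero (b := (-(2 * t)) • J)]
  congr! 1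
  simp only [Matrix.transpose_add, Matrix.transpose_smul, Matrix.transpose_one, Matrix.add_mul,
    Matrix.mul_add, Matrix.smul_mul, Matrix.mul_smul, Matrix.one_mul, Matrix.mul_one]
  module

theorem mul_add_mul_transpose_eq_trace_add_smul_iff [NeZero (2 : K)] (hJ : J * J = -1)
    (h_card : (Fintype.card ι : K) ≠ 2) (c : K) :
    a * J + J * a.transpose = (a.trace + c) • J ↔
      (a + (c / (Fintype.card ι - 2)) • 1).transpose * J +
        J * (a + (c / (Fintype.card ι - 2)) • 1) = 0 := by
  have h_sub : (Fintype.card ι : K) - 2 ≠ 0 := sub_ne_zero.2 h_card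
  have h_two : (2 : K) ≠ 0 := two_ne_zero
  rw [mul_add_mul_transpose_eq_smul_iff hJ, transpose_add_smul_one_mul_add_eq_zero_iff]
  constructor <;> intro h <;> have h_trace := two_mul_trace_eq hJ h <;> rw [h] <;> congr 1
  · field_simp
    linear_combination -h_trace
  · refine mul_left_cancel₀ h_two ?_
    field_simp at h_trace ⊢
    linear_combination -h_trace

end

end StabilizerAlgebras

section Similarity

variable {U : Type*} [AddCommGroup U] [Module ℝ U]

theorem mem_symplecticAlgebra_iff {ι : Type*} [Fintype ι] [DecidableEq ι]
    (u : Module.Basis ι ℝ U) {ω : LinearMap.BilinForm ℝ U} {A : Module.End ℝ U} :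
    A ∈ symplecticAlgebra ω ↔
      (LinearMap.toMatrix u u A).transpose * LinearMap.BilinForm.toMatrix u ω +
        LinearMap.BilinForm.toMatrix u ω * LinearMap.toMatrix u u A = 0 := by
  rw [← LinearMap.BilinForm.toMatrix_compLeft, ← LinearMap.BilinForm.toMatrix_compRight, ← map_add,
    LinearEquiv.map_eq_zero_iff, LinearMap.ext_iff₂]
  rfl

theorem exists_basis_toMatrix_eq_skewMatrix {K V : Type*} [Field K] [AddCommGroup V]
    [Module K V] [FiniteDimensional K V] {k : ℕ} (hV : Module.finrank K V = 2 * k)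
    {ω : LinearMap.BilinForm K V} (h_alt : ω.IsAlt) (h_nondeg : ω.Nondegenerate) :
    ∃ u : Module.Basis (Fin (2 * k)) K V,
      LinearMap.BilinForm.toMatrix u ω = skewMatrix K (2 * k) k := by
  obtain ⟨l, hl, u, hu⟩ := exists_basis_apply_eq_standardSkew hV h_alt
  obtain rfl | hlt : l = k ∨ l < k := by lia
  · exact ⟨u, by ext i j; simp [hu, skewMatrix]⟩
  · have h_last : u ⟨2 * k - 1, by lia⟩ = 0 := by
      refine h_nondeg.1 _ fun y => ?_
      suffices h : ω (u ⟨2 * k - 1, by lia⟩) = 0 by rw [h, LinearMap.zero_apply]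
      exact u.ext fun j => by
        rw [hu, standardSkew_eq_zero (by simp only; lia), Int.cast_zero, LinearMap.zero_apply]
    exact absurd h_last (u.ne_zero _)

theorem isSimilarToElementOf_iff_exists_basis {ι : Type*} [Fintype ι] [DecidableEq ι]
    (u : Module.Basis ι ℝ U) {S : Set (Module.End ℝ U)} {P : Matrix ι ι ℝ → Prop}
    (hS : ∀ A, A ∈ S ↔ P (LinearMap.toMatrix u u A)) (A : Module.End ℝ U) :
    IsSimilarToElementOf A S ↔ ∃ v : Module.Basis ι ℝ U, P (LinearMap.toMatrix v v A) := by
  have h_map (T : U ≃ₗ[ℝ] U) : LinearMap.toMatrix (u.map T.symm) (u.map T.symm) A =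
      LinearMap.toMatrix u u (T.conj A) := by
    ext i j
    simp [LinearMap.toMatrix_apply, LinearEquiv.conj_apply]
  constructor
  · rintro ⟨T, hT⟩
    exact ⟨u.map T.symm, by rwa [h_map, ← hS]⟩
  · rintro ⟨v, hv⟩
    refine ⟨v.equiv u (Equiv.refl ι), ?_⟩
    rwa [hS, ← h_map, show u.map (v.equiv u (Equiv.refl ι)).symm = v by ext; simp]

theorem isSimilarToElementOf_symplecticAlgebra_iff [FiniteDimensional ℝ U] {k : ℕ} (hk : k ≠ 1)
    (hU : Module.finrank ℝ U = 2 * k) {ω : LinearMap.BilinForm ℝ U} (h_alt : ω.IsAlt)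
    (h_nondeg : ω.Nondegenerate) (A : Module.End ℝ U) :
    IsSimilarToElementOf A (symplecticAlgebra ω) ↔ ∃ v : Module.Basis (Fin (2 * k)) ℝ U,
      RescalesByTrace (LinearMap.toMatrix v v A) (skewMatrix ℝ (2 * k) k) := by
  obtain ⟨u, hu⟩ := exists_basis_toMatrix_eq_skewMatrix hU h_alt h_nondeg
  have h_card : (Fintype.card (Fin (2 * k)) : ℝ) ≠ 2 := by
    rw [Fintype.card_fin]
    exact_mod_cast show 2 * k ≠ 2 by lia
  refine isSimilarToElementOf_iff_exists_basis u (P := (RescalesByTrace · _)) (fun A => ?_) A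
  have h_iff := mul_add_mul_transpose_eq_trace_add_smul_iff (a := LinearMap.toMatrix u u A)
    (skewMatrix_mul_self ℝ k) h_card 0
  simp only [zero_div, zero_smul, add_zero] at h_iff
  rw [mem_symplecticAlgebra_iff u, hu, RescalesByTrace, h_iff]

variable {ι κ : Type*} [Fintype ι] [Fintype κ]

theorem toMatrix_eq_fromBlocks_iff [DecidableEq ι] [DecidableEq κ] {R M : Type*} [CommRing R]
    [AddCommGroup M] [Module R M]
    {p q : Submodule R M} (h : IsCompl p q) (c : Module.Basis ι R p) (d : Module.Basis κ R q)
    {u : Module.Basis (ι ⊕ κ) R M} (hu : u = (c.prod d).map (p.prodEquivOfIsCompl q h))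
    (A : Module.End R M) (f₁₁ : p →ₗ[R] p) (f₁₂ : q →ₗ[R] p) (f₂₁ : p →ₗ[R] q) (f₂₂ : q →ₗ[R] q) :
    LinearMap.toMatrix u u A = Matrix.fromBlocks (LinearMap.toMatrix c c f₁₁)
        (LinearMap.toMatrix d c f₁₂) (LinearMap.toMatrix c d f₂₁) (LinearMap.toMatrix d d f₂₂) ↔
      (∀ x : p, A x = f₁₁ x + f₂₁ x) ∧ ∀ y : q, A y = f₁₂ y + f₂₂ y := by
  let E := p.prodEquivOfIsCompl q h
  let F : p × q →ₗ[R] p × q := (f₁₁.coprod f₁₂).prod (f₂₁.coprod f₂₂)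
  have h_matrix : LinearMap.toMatrix u u (E.conj F) = Matrix.fromBlocks (LinearMap.toMatrix c c f₁₁)
      (LinearMap.toMatrix d c f₁₂) (LinearMap.toMatrix c d f₂₁) (LinearMap.toMatrix d d f₂₂) := by
    subst hu
    ext (i | i) (j | j) <;> simp [LinearMap.toMatrix_apply, LinearEquiv.conj_apply, E, F]
  have h_conj : A = E.conj F ↔ A ∘ₗ E = E ∘ₗ F := by
    rw [LinearEquiv.conj_apply, LinearEquiv.eq_comp_toLinearMap_symm]
  rw [← h_matrix, (LinearMap.toMatrix u u).injective.eq_iff, h_conj, LinearMap.prod_ext_iff,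
    LinearMap.ext_iff, LinearMap.ext_iff]
  simp [E, F]

theorem mem_lengthTwoStabilizer_iff [DecidableEq ι] [DecidableEq κ]
    {V₂ V₄ : Submodule ℝ U} (hV : IsCompl V₄ V₂)
    (c : Module.Basis ι ℝ V₄) (d : Module.Basis κ ℝ V₂) {u : Module.Basis (ι ⊕ κ) ℝ U}
    (hu : u = (c.prod d).map (V₄.prodEquivOfIsCompl V₂ hV))
    {ω₄ : LinearMap.BilinForm ℝ V₄} {J : Matrix ι ι ℝ} (hJ : LinearMap.BilinForm.toMatrix c ω₄ = J)
    {A : Module.End ℝ U} {a : Matrix (ι ⊕ κ) (ι ⊕ κ) ℝ} (ha : LinearMap.toMatrix u u A = a) :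
    A ∈ lengthTwoStabilizer V₂ V₄ ω₄ ↔ a.toBlocks₂₁ = 0 ∧
      (a.toBlocks₁₁ + (a.toBlocks₂₂.trace / 2) • 1).transpose * J +
        J * (a.toBlocks₁₁ + (a.toBlocks₂₂.trace / 2) • 1) = 0 := by
  constructor
  · rintro ⟨f₂, h, f₄, hf₄, h_V₂, h_V₄⟩
    have h_blocks := (toMatrix_eq_fromBlocks_iff hV c d hu A
      (-(LinearMap.trace ℝ V₂ f₂ / 2) • 1 + f₄) h 0 f₂).2
        ⟨fun x => by simp [h_V₄ x], fun y => by rw [h_V₂, add_comm]⟩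
    rw [mem_symplecticAlgebra_iff c, hJ] at hf₄
    rw [← ha, h_blocks, Matrix.toBlocks_fromBlocks₂₂]
    have h_cancel : LinearMap.toMatrix c c (-(LinearMap.trace ℝ V₂ f₂ / 2) • 1 + f₄) +
        (LinearMap.trace ℝ V₂ f₂ / 2) • 1 = LinearMap.toMatrix c c f₄ := by
      rw [map_add, map_smul, LinearMap.toMatrix_one]
      module
    rw [← LinearMap.trace_eq_matrix_trace, Matrix.toBlocks_fromBlocks₁₁, h_cancel,
      Matrix.toBlocks_fromBlocks₂₁, map_zero]
    exact ⟨rfl, hf₄⟩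
  · rintro ⟨h_zero, h_symp⟩
    have h_blocks := (toMatrix_eq_fromBlocks_iff hV c d hu A
      (Matrix.toLin c c a.toBlocks₁₁) (Matrix.toLin d c a.toBlocks₁₂) 0
      (Matrix.toLin d d a.toBlocks₂₂)).1 (by
        simp only [LinearMap.toMatrix_toLin, map_zero, ← h_zero, Matrix.fromBlocks_toBlocks, ha])
    refine ⟨Matrix.toLin d d a.toBlocks₂₂, Matrix.toLin d c a.toBlocks₁₂,
      Matrix.toLin c c (a.toBlocks₁₁ + (a.toBlocks₂₂.trace / 2) • 1), ?_, fun x => ?_, fun y => ?_⟩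
    · rwa [mem_symplecticAlgebra_iff c, LinearMap.toMatrix_toLin, hJ]
    · rw [h_blocks.2 x, add_comm]
    · rw [h_blocks.1 y, LinearMap.trace_eq_matrix_trace ℝ d, LinearMap.toMatrix_toLin]
      simp [Matrix.toLin_one]

theorem rescalesByTrace_fromBlocks_iff {R : Type*} [CommRing R] [DecidableEq ι]
    {J : Matrix ι ι R} (hJ : J * J = -1) (a : Matrix (ι ⊕ κ) (ι ⊕ κ) R) :
    RescalesByTrace a (Matrix.fromBlocks J 0 0 0) ↔ a.toBlocks₂₁ = 0 ∧
      a.toBlocks₁₁ * J + J * a.toBlocks₁₁.transpose =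
        (a.toBlocks₁₁.trace + a.toBlocks₂₂.trace) • J := by
  obtain ⟨a₁₁, a₁₂, a₂₁, a₂₂, rfl⟩ : ∃ a₁₁ a₁₂ a₂₁ a₂₂, a = Matrix.fromBlocks a₁₁ a₁₂ a₂₁ a₂₂ :=
    ⟨_, _, _, _, a.fromBlocks_toBlocks.symm⟩
  have h_zero (h : a₂₁ * J = 0) : a₂₁ = 0 := by
    calc a₂₁ = -(a₂₁ * J * J) := by rw [Matrix.mul_assoc, hJ]; simp
      _ = 0 := by rw [h]; simp
  simp only [RescalesByTrace, Matrix.fromBlocks_transpose, Matrix.fromBlocks_multiply,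
    Matrix.trace, Matrix.diag, Fintype.sum_sum_type, Matrix.fromBlocks_apply₁₁,
    Matrix.fromBlocks_apply₂₂, Matrix.fromBlocks_smul, Matrix.fromBlocks_add, Matrix.fromBlocks_inj,
    Matrix.toBlocks_fromBlocks₁₁, Matrix.toBlocks_fromBlocks₂₁, Matrix.toBlocks_fromBlocks₂₂,
    Matrix.mul_zero, Matrix.zero_mul, add_zero, zero_add, smul_zero, and_true]
  constructor
  · rintro ⟨h, -, h₂₁⟩
    exact ⟨h_zero h₂₁, h⟩
  · rintro ⟨rfl, h⟩
    simp [h]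

theorem rescalesByTrace_submatrix_iff {R : Type*} [CommRing R] (σ : ι ≃ κ) (a B : Matrix κ κ R) :
    RescalesByTrace (a.submatrix σ σ) (B.submatrix σ σ) ↔ RescalesByTrace a B := by
  have h_trace : (a.submatrix σ σ).trace = a.trace := σ.sum_comp fun i => a i i
  rw [RescalesByTrace, RescalesByTrace, Matrix.transpose_submatrix, Matrix.submatrix_mul_equiv,
    Matrix.submatrix_mul_equiv, h_trace]
  exact (Matrix.reindex σ.symm σ.symm).injective.eq_iff
    (a := a * B + B * a.transpose) (b := a.trace • B)

theorem skewMatrix_submatrix_finSumFinEquiv (R : Type*) [Ring R] (k m : ℕ) :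
    (skewMatrix R (2 * k + m) k).submatrix finSumFinEquiv finSumFinEquiv =
      Matrix.fromBlocks (skewMatrix R (2 * k) k) 0 0 0 := by
  have h_swap {i : ℕ} (j : ℕ) (hj : 2 * k ≤ j) : standardSkew k i j = 0 := by
    rw [standardSkew_swap, standardSkew_eq_zero hj, neg_zero]
  ext (i | i) (j | j) <;> simp [skewMatrix, standardSkew_eq_zero, h_swap]

theorem isSimilarToElementOf_lengthTwoStabilizer_iff {V₂ V₄ : Submodule ℝ U}
    [FiniteDimensional ℝ U] {m : ℕ} (hV₄ : Module.finrank ℝ V₄ = 4)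
    (hV₂ : Module.finrank ℝ V₂ = m) (hV : IsCompl V₂ V₄) {ω₄ : LinearMap.BilinForm ℝ V₄}
    (h_alt : ω₄.IsAlt) (h_nondeg : ω₄.Nondegenerate) (A : Module.End ℝ U) :
    IsSimilarToElementOf A (lengthTwoStabilizer V₂ V₄ ω₄) ↔
      ∃ v : Module.Basis (Fin (4 + m)) ℝ U,
        RescalesByTrace (LinearMap.toMatrix v v A) (skewMatrix ℝ (4 + m) 2) := by
  obtain ⟨c, hc⟩ := exists_basis_toMatrix_eq_skewMatrix (k := 2) hV₄ h_alt h_nondeg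
  let d := Module.finBasisOfFinrankEq ℝ V₂ hV₂
  let u := (c.prod d).map (V₄.prodEquivOfIsCompl V₂ hV.symm)
  refine isSimilarToElementOf_iff_exists_basis (u.reindex finSumFinEquiv)
    (P := (RescalesByTrace · _)) (fun A => ?_) A
  have h_reindex : (LinearMap.toMatrix (u.reindex finSumFinEquiv) (u.reindex finSumFinEquiv)
      A).submatrix finSumFinEquiv finSumFinEquiv = LinearMap.toMatrix u u A := by
    ext i j
    simp [LinearMap.toMatrix_apply]
  have hJ := skewMatrix_mul_self ℝ 2
  have h_trace := mul_add_mul_transpose_eq_trace_add_smul_iff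
    (a := (LinearMap.toMatrix u u A).toBlocks₁₁) hJ (by norm_num)
    (LinearMap.toMatrix u u A).toBlocks₂₂.trace
  rw [show (Fintype.card (Fin (2 * 2)) : ℝ) - 2 = 2 by norm_num] at h_trace
  rw [← rescalesByTrace_submatrix_iff finSumFinEquiv, h_reindex,
    skewMatrix_submatrix_finSumFinEquiv ℝ 2 m, rescalesByTrace_fromBlocks_iff hJ, h_trace]
  exact mem_lengthTwoStabilizer_iff hV.symm c d rfl hc rfl

end Similarity

section InteriorProduct

theorem le_finrank_ker_add_of_standardSkew {K V : Type*} [Field K] [AddCommGroup V] [Module K V]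
    [FiniteDimensional K V] {B : LinearMap.BilinForm K V} {d k : ℕ}
    (w : Module.Basis (Fin (d + 1)) K V) (h_left : B (w 0) = 0) (h_right : ∀ x, B x (w 0) = 0)
    (hw : ∀ i j : Fin d, B (w i.succ) (w j.succ) = (standardSkew k i j : K)) :
    d + 1 ≤ Module.finrank K (LinearMap.ker B) + 2 * k := by
  have h_ker (i : Fin d) (hi : ¬ (i : ℕ) < 2 * k) : B (w i.succ) = 0 := by
    refine w.ext fun j => ?_
    refine Fin.cases ?_ (fun j => ?_) j
    · rw [h_right, LinearMap.zero_apply]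
    · rw [hw, standardSkew_eq_zero (not_lt.1 hi), Int.cast_zero, LinearMap.zero_apply]
  have h_card := card_le_finrank_ker w B
    (insert 0 ((Finset.univ.filter fun i : Fin d => ¬ (i : ℕ) < 2 * k).map (Fin.succEmb d))) (by
      simpa [h_left] using h_ker)
  rw [Finset.card_insert_of_notMem (by simp [Fin.succ_ne_zero]), Finset.card_map] at h_card
  have h_compl := Finset.card_filter_add_card_filter_not (s := Finset.univ)
    fun i : Fin d => (i : ℕ) < 2 * k
  rw [Fin.card_filter_val_lt, Finset.card_univ, Fintype.card_fin] at h_compl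
  lia

theorem ker_le_span_of_standardSkew {K V : Type*} [Field K] [AddCommGroup V] [Module K V]
    {B : LinearMap.BilinForm K V} {k : ℕ} (w : Module.Basis (Fin (2 * k + 1)) K V)
    (h_left : B (w 0) = 0)
    (hw : ∀ i j : Fin (2 * k), B (w i.succ) (w j.succ) = (standardSkew k i j : K)) :
    LinearMap.ker B ≤ K ∙ w 0 := by
  intro x hx
  have h_mul : Matrix.vecMul (fun i : Fin (2 * k) => w.repr x i.succ) (skewMatrix K (2 * k) k) =
      0 := by
    ext j
    have h_apply : B x (w j.succ) = 0 := LinearMap.congr_fun hx _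
    rw [← w.sum_repr x, Fin.sum_univ_succ, map_add, map_smul, h_left, smul_zero, zero_add, map_sum,
      LinearMap.sum_apply] at h_apply
    simpa [hw, Matrix.vecMul, dotProduct, skewMatrix] using h_apply
  have h_zero : (fun i : Fin (2 * k) => w.repr x i.succ) = 0 := by
    have h_mul_self := congrArg (Matrix.vecMul · (skewMatrix K (2 * k) k)) h_mul
    simpa only [Matrix.vecMul_vecMul, skewMatrix_mul_self, Matrix.vecMul_neg, Matrix.vecMul_one,
      Matrix.zero_vecMul, neg_eq_zero] using h_mul_self
  rw [← w.sum_repr x, Fin.sum_univ_succ, Finset.sum_eq_zero fun i _ => by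
    rw [show w.repr x i.succ = 0 from congrFun h_zero i, zero_smul], add_zero]
  exact Submodule.smul_mem _ _ (Submodule.mem_span_singleton_self _)

variable {V : Type*} [AddCommGroup V] [Module ℝ V] (δ : ℤˣ) (e : Module.Basis (Fin 7) ℝ V)

theorem modelMetric_apply (x y : V) :
    modelMetric δ e x y = ∑ i, (metricSign δ i : ℝ) * (e.repr x i * e.repr y i) := by
  simp [modelMetric, Matrix.toBilin_apply, Matrix.diagonal_apply, mul_left_comm, mul_assoc]

theorem modelMetric_isSymm : (modelMetric δ e).IsSymm :=
  ⟨fun x y => by simp only [modelMetric_apply, mul_comm]⟩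

theorem modelMetric_nondegenerate : (modelMetric δ e).Nondegenerate :=
  LinearMap.BilinForm.nondegenerate_of_det_ne_zero _ e (by simp [det_toMatrix_modelMetric])

theorem modelForm_apply (x y z : V) :
    modelForm δ e ![x, y, z] = ∑ t, (tripleCoeff δ t : ℝ) *
      (Matrix.of fun i j => e.repr (![x, y, z] i) (tripleIndex t j)).det := by
  simp [modelForm, alternatingMap_sum_apply, basisForm, wedgeOneForms_apply, Matrix.det_fin_three]

theorem sum_modelForm_mul_modelForm (n x y : V) :
    ∑ c, (metricSign δ c : ℝ) * (modelForm δ e ![n, x, e c] * modelForm δ e ![n, y, e c]) =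
      modelMetric δ e n n * modelMetric δ e x y - modelMetric δ e n x * modelMetric δ e n y := by
  simp only [modelForm_apply, modelMetric_apply]
  rcases Int.units_eq_one_or δ with rfl | rfl <;>
  · simp [Fin.sum_univ_succ, Matrix.det_fin_three, metricSign, tripleIndex, tripleCoeff,
      Finsupp.single_apply]
    ring

variable {δ e}

theorem eq_zero_of_modelMetric_self_eq_zero {x : V} (h : modelMetric δ e x x = 0)
    (h_coord : ∀ i, 4 ≤ i → e.repr x i = 0) : x = 0 := by
  have h_sq : ∑ i, e.repr x i ^ 2 = 0 := by
    have h_sign (i : Fin 7) : (metricSign δ i : ℝ) * (e.repr x i * e.repr x i) =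
        ((δ : ℤ) : ℝ) * e.repr x i ^ 2 := by
      by_cases hi : 4 ≤ i
      · simp [h_coord i hi]
      · fin_cases i <;> simp_all [metricSign, sq]
    rw [modelMetric_apply, Finset.sum_congr rfl fun i _ => h_sign i, ← Finset.mul_sum] at h
    exact (mul_eq_zero.1 h).resolve_left (by exact_mod_cast δ.ne_zero)
  refine e.repr.map_eq_zero_iff.1 (Finsupp.ext fun i => ?_)
  have := (Finset.sum_eq_zero_iff_of_nonneg fun i _ => sq_nonneg _).1 h_sq i (Finset.mem_univ i)
  simpa using this

/-- The interior product `n ⌟ φ` with a three-form `φ`, as a bilinear form. -/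
def interiorForm {V : Type*} [AddCommGroup V] [Module ℝ V] (φ : V [⋀^Fin 3]→ₗ[ℝ] ℝ) (n : V) :
    LinearMap.BilinForm ℝ V :=
  LinearMap.mk₂ ℝ (fun x y => φ ![n, x, y])
    (fun x x' y => DFunLike.congr_fun (map_add (φ.curryLeft n).curryLeft x x') ![y])
    (fun c x y => DFunLike.congr_fun (map_smul (φ.curryLeft n).curryLeft c x) ![y])
    (fun x y y' => DFunLike.congr_fun (map_add ((φ.curryLeft n).curryLeft x).curryLeft y y') ![])
    (fun c x y => DFunLike.congr_fun (map_smul ((φ.curryLeft n).curryLeft x).curryLeft c y) ![])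

theorem interiorForm_apply (φ : V [⋀^Fin 3]→ₗ[ℝ] ℝ) (n x y : V) :
    interiorForm φ n x y = φ ![n, x, y] := rfl

theorem interiorForm_isAlt (φ : V [⋀^Fin 3]→ₗ[ℝ] ℝ) (n : V) : (interiorForm φ n).IsAlt :=
  fun x => φ.map_eq_zero_of_eq ![n, x, x] (i := 1) (j := 2) rfl (by decide)

theorem interiorForm_self (φ : V [⋀^Fin 3]→ₗ[ℝ] ℝ) (n : V) : interiorForm φ n n = 0 :=
  LinearMap.ext fun y => φ.map_eq_zero_of_eq ![n, n, y] (i := 0) (j := 1) rfl (by decide)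

theorem modelMetric_smul_eq_of_mem_ker {n x : V}
    (hx : x ∈ LinearMap.ker (interiorForm (modelForm δ e) n)) :
    modelMetric δ e n n • x = modelMetric δ e n x • n := by
  refine sub_eq_zero.1 ((modelMetric_nondegenerate δ e).1 _ fun y => ?_)
  have h_zero (z : V) : modelForm δ e ![n, x, z] = 0 := LinearMap.congr_fun hx z
  have h_sum := sum_modelForm_mul_modelForm δ e n x y
  simp only [h_zero, zero_mul, mul_zero, Finset.sum_const_zero] at h_sum
  simpa using h_sum.symm

theorem modelMetric_self_eq_zero_of_mem_ker {n x : V} (hn : n ≠ 0)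
    (h_null : modelMetric δ e n n = 0)
    (hx : x ∈ LinearMap.ker (interiorForm (modelForm δ e) n)) : modelMetric δ e x x = 0 := by
  have h_swap : n ∈ LinearMap.ker (interiorForm (modelForm δ e) x) := by
    refine LinearMap.ext fun z => ?_
    have h_vec : ![x, n, z] = ![n, x, z] ∘ Equiv.swap 0 1 := by
      ext i
      fin_cases i <;> rfl
    rw [interiorForm_apply, h_vec, (modelForm δ e).map_swap _ (by decide), ← interiorForm_apply,
      hx, LinearMap.zero_apply, neg_zero]
  have h_orth := modelMetric_smul_eq_of_mem_ker hx
  rw [h_null, zero_smul, eq_comm, smul_eq_zero_iff_left hn] at h_orth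
  have h_self := modelMetric_smul_eq_of_mem_ker h_swap
  rwa [← (modelMetric_isSymm δ e).eq n x, h_orth, zero_smul, smul_eq_zero_iff_left hn] at h_self

variable (δ e) in
theorem finrank_le_three_of_isotropic {W : Submodule ℝ V}
    (hW : ∀ x ∈ W, modelMetric δ e x x = 0) : Module.finrank ℝ W ≤ 3 := by
  let f : W →ₗ[ℝ] Fin 3 → ℝ := LinearMap.pi (fun i => e.coord (Fin.natAdd 4 i)) ∘ₗ W.subtype
  have h_inj : Function.Injective f := (injective_iff_map_eq_zero f).2 fun x hx => by
    refine Subtype.ext (eq_zero_of_modelMetric_self_eq_zero (hW x x.2) fun i hi => ?_)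
    obtain ⟨i, rfl⟩ : ∃ i' : Fin 3, i = Fin.natAdd 4 i' :=
      ⟨⟨i - 4, by lia⟩, Fin.ext (by simp; lia)⟩
    exact congrFun hx i
  simpa using LinearMap.finrank_le_finrank_of_injective h_inj

theorem finrank_ker_interiorForm_le_one {n : V} (hn : modelMetric δ e n n ≠ 0) :
    Module.finrank ℝ (LinearMap.ker (interiorForm (modelForm δ e) n)) ≤ 1 := by
  have h_le : LinearMap.ker (interiorForm (modelForm δ e) n) ≤ ℝ ∙ n := fun x hx =>
    Submodule.mem_span_singleton.2 ⟨(modelMetric δ e n n)⁻¹ * modelMetric δ e n x, by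
      rw [mul_smul, ← modelMetric_smul_eq_of_mem_ker hx, inv_smul_smul₀ hn]⟩
  exact (Submodule.finrank_mono h_le).trans (finrank_span_le_card {n} |>.trans (by simp))

theorem interiorForm_apply_of_modelMetric_eq {n x z : V}
    (hz : modelMetric δ e z = interiorForm (modelForm δ e) n x) (y : V) :
    interiorForm (modelForm δ e) n y z =
      modelMetric δ e n n * modelMetric δ e x y - modelMetric δ e n x * modelMetric δ e n y := by
  have h_sign : ∀ (δ : ℤˣ) c, metricSign δ c * metricSign δ c = 1 := by decide
  have h_repr (c : Fin 7) : e.repr z c = metricSign δ c * modelForm δ e ![n, x, e c] := by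
    have h_sq : (metricSign δ c : ℝ) * metricSign δ c = 1 := by exact_mod_cast h_sign δ c
    rw [← interiorForm_apply, ← hz, modelMetric_apply]
    simp [Finsupp.single_apply, ← mul_assoc, h_sq]
  rw [← sum_modelForm_mul_modelForm]
  nth_rewrite 1 [← e.sum_repr z]
  rw [map_sum]
  refine Finset.sum_congr rfl fun c _ => ?_
  rw [map_smul, h_repr, smul_eq_mul, interiorForm_apply, mul_assoc]

theorem three_le_finrank_ker_interiorForm {n : V} (hn : n ≠ 0) (h_null : modelMetric δ e n n = 0) :
    3 ≤ Module.finrank ℝ (LinearMap.ker (interiorForm (modelForm δ e) n)) := by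
  have : FiniteDimensional ℝ V := Module.Finite.of_basis e
  set B := interiorForm (modelForm δ e) n
  let f := B.domRestrict (LinearMap.ker (modelMetric δ e n))
  have h_range : LinearMap.range f ≤ (LinearMap.ker B).map (modelMetric δ e) := by
    rintro _ ⟨x, rfl⟩
    obtain ⟨z, hz⟩ := ((modelMetric δ e).toDual (modelMetric_nondegenerate δ e)).surjective (B x)
    refine ⟨z, LinearMap.ext fun y => ?_, hz⟩
    rw [← (interiorForm_isAlt _ n).neg_eq, interiorForm_apply_of_modelMetric_eq hz, h_null,
      LinearMap.mem_ker.1 x.2]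
    simp
  have h_ker : Module.finrank ℝ (LinearMap.ker f) ≤ Module.finrank ℝ (LinearMap.ker B) := by
    rw [← Submodule.finrank_map_subtype_eq]
    exact Submodule.finrank_mono (by rintro _ ⟨x, hx, rfl⟩; exact hx)
  have h_rank := f.finrank_range_add_finrank_ker
  have h_perp := Module.Dual.finrank_ker_add_one_of_ne_zero (f := modelMetric δ e n) fun h =>
    hn ((modelMetric_nondegenerate δ e).1 n fun y => LinearMap.congr_fun h y)
  rw [Module.finrank_eq_card_basis e, Fintype.card_fin] at h_perp
  have := (Submodule.finrank_mono h_range).trans (Submodule.finrank_map_le _ _)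
  lia

/-- Half of the rank of the two-form `n ⌟ φ`, where `φ` is a standard three-form, `n` is a non-zero
vector and `q = g(n, n)` is its square with respect to the metric of `φ`. -/
noncomputable def interiorHalfRank (q : ℝ) : ℕ :=
  open Classical in if q = 0 then 2 else 3

variable (δ e) in
theorem exists_basis_modelForm_eq_standardSkew {n : V} (hn : n ≠ 0) :
    ∃ w : Module.Basis (Fin 7) ℝ V, w 0 = n ∧ ∀ i j : Fin 6,
      modelForm δ e ![n, w i.succ, w j.succ] =
        standardSkew (interiorHalfRank (modelMetric δ e n n)) i j := by
  have : FiniteDimensional ℝ V := Module.Finite.of_basis e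
  have h_alt := interiorForm_isAlt (modelForm δ e) n
  obtain ⟨k, hk, w, hw_zero, hw⟩ := exists_basis_cons_apply_eq_standardSkew (d := 6)
    (by simp [Module.finrank_eq_card_basis e]) h_alt hn
  have h_left : interiorForm (modelForm δ e) n (w 0) = 0 := by rw [hw_zero, interiorForm_self]
  have h_rank := le_finrank_ker_add_of_standardSkew w h_left
    (fun x => by rw [← h_alt.neg_eq, h_left, LinearMap.zero_apply, neg_zero]) hw
  suffices h_eq : k = interiorHalfRank (modelMetric δ e n n) from ⟨w, hw_zero, h_eq ▸ hw⟩
  rcases eq_or_ne (modelMetric δ e n n) 0 with h_null | h_null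
  · have h_le := finrank_le_three_of_isotropic δ e fun x hx =>
      modelMetric_self_eq_zero_of_mem_ker hn h_null hx
    have h_ge := three_le_finrank_ker_interiorForm hn h_null
    have h_ne : k ≠ 3 := by
      rintro rfl
      have h_span := Submodule.finrank_mono (ker_le_span_of_standardSkew (k := 3) w h_left hw)
      rw [hw_zero, finrank_span_singleton hn] at h_span
      lia
    rw [interiorHalfRank, if_pos h_null]
    lia
  · have h_le := finrank_ker_interiorForm_le_one h_null
    rw [interiorHalfRank, if_neg h_null]
    lia

end InteriorProduct

section CodimensionOneIdeal

theorem formDerivation_compLinearMap {R U V : Type*} [CommRing R] [AddCommGroup U] [Module R U]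
    [AddCommGroup V] [Module R V] {k : ℕ} {D : Module.End R V} {A : Module.End R U}
    {f : U →ₗ[R] V} (h : D ∘ₗ f = f ∘ₗ A) (Ψ : V [⋀^Fin (k + 1)]→ₗ[R] R) :
    (formDerivation D Ψ).compLinearMap f = formDerivation A (Ψ.compLinearMap f) := by
  ext u
  simp only [AlternatingMap.compLinearMap_apply, formDerivation_apply_update]
  refine Finset.sum_congr rfl fun p _ => congrArg Ψ ?_
  exact (congrArg _ (LinearMap.congr_fun h (u p))).trans (Function.comp_update f u p _).symm

theorem exists_dual_apply_eq_one_and_ker {K V : Type*} [Field K] [AddCommGroup V] [Module K V]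
    [FiniteDimensional K V] {W : Submodule K V}
    (hW : Module.finrank K W + 1 = Module.finrank K V) {x : V} (hx : x ∉ W) :
    ∃ θ : Module.Dual K V, θ x = 1 ∧ LinearMap.ker θ = W := by
  obtain ⟨f, hfx, hf⟩ := Submodule.exists_le_ker_of_notMem hx
  refine ⟨(f x)⁻¹ • f, inv_mul_cancel₀ hfx, ?_⟩
  rw [LinearMap.ker_smul _ _ (inv_ne_zero hfx)]
  refine (Submodule.eq_of_le_of_finrank_eq hf ?_).symm
  have h_rank := Module.Dual.finrank_ker_add_one_of_ne_zero (f := f) fun h => hfx (by simp [h])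
  lia

variable {L : Type*} [LieRing L] [LieAlgebra ℝ L] {I : LieIdeal ℝ L} {θ : Module.Dual ℝ L} {x₀ : L}

theorem lie_eq_of_ker_eq_abelian_ideal [IsLieAbelian I] (hθ : θ x₀ = 1)
    (h_ker : LinearMap.ker θ = I.toSubmodule) (x y : L) :
    ⁅x, y⁆ = θ x • LieAlgebra.ad ℝ L x₀ y - θ y • LieAlgebra.ad ℝ L x₀ x := by
  have h_mem (z : L) : z - θ z • x₀ ∈ I := by
    change _ ∈ I.toSubmodule
    simp [← h_ker, hθ]
  have h_comm : ⁅x - θ x • x₀, y - θ y • x₀⁆ = 0 :=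
    congrArg Subtype.val (trivial_lie_zero I I ⟨_, h_mem x⟩ ⟨_, h_mem y⟩)
  simp only [lie_sub, sub_lie, lie_smul, smul_lie, lie_self, smul_zero, sub_zero,
    ← lie_skew x x₀] at h_comm
  rw [LieAlgebra.ad_apply, LieAlgebra.ad_apply, ← sub_eq_zero, ← h_comm]
  module

theorem exists_basis_cons_eq {K V : Type*} [Field K] [AddCommGroup V] [Module K V] {n : ℕ}
    {W : Submodule K V} {θ : Module.Dual K V} {x₀ : V} (hθ : θ x₀ = 1)
    (h_ker : LinearMap.ker θ = W) (v : Module.Basis (Fin n) K W) :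
    ∃ b : Module.Basis (Fin (n + 1)) K V, b 0 = x₀ ∧ ∀ i : Fin n, b i.succ = v i := by
  subst h_ker
  let b : Module.Basis (Fin (n + 1)) K V := Module.Basis.mkFinCons x₀ v
    (fun c x hx h => by
      rw [LinearMap.mem_ker] at hx
      simpa [hθ, hx] using congrArg θ h)
    (fun z => ⟨-θ z, by simp [hθ]⟩)
  exact ⟨b, by simp [b], fun i => by simp [b]⟩

theorem isClosedForm_iff_formDerivation_restrict_eq_zero [IsLieAbelian I] (hθ : θ x₀ = 1)
    (h_ker : LinearMap.ker θ = I.toSubmodule) {n k : ℕ} (v : Module.Basis (Fin n) ℝ I)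
    (Ψ : L [⋀^Fin (k + 1)]→ₗ[ℝ] ℝ) :
    IsClosedForm Ψ ↔ formDerivation (LieModule.toEnd ℝ L I x₀)
      (Ψ.compLinearMap I.toSubmodule.subtype) = 0 := by
  have h_mem (x : L) : θ x = 0 ↔ x ∈ I := by
    rw [← LinearMap.mem_ker, h_ker]
    rfl
  obtain ⟨b, h_zero, h_succ⟩ := exists_basis_cons_eq hθ h_ker v
  rw [isClosedForm_iff_formDerivation_eq_zero (lie_eq_of_ker_eq_abelian_ideal hθ h_ker) b
    (by rw [h_zero, hθ]) (fun i => by rw [h_succ, h_mem]; exact (v i).2), AlternatingMap.ext_iff,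
    ← formDerivation_compLinearMap (D := LieAlgebra.ad ℝ L x₀) (f := I.toSubmodule.subtype)
      (LinearMap.ext fun _ => rfl)]
  exact ⟨fun h u => h _ fun i => (h_mem _).2 (u i).2,
    fun h u hu => h fun i => ⟨u i, (h_mem _).1 (hu i)⟩⟩

theorem IsHodgeDual.apply_perm_mul_vol {V : Type*} [AddCommGroup V] [Module ℝ V]
    {g : LinearMap.BilinForm ℝ V} {vol : V [⋀^Fin 7]→ₗ[ℝ] ℝ} {ψ : V [⋀^Fin 3]→ₗ[ℝ] ℝ}
    {Ψ : V [⋀^Fin 4]→ₗ[ℝ] ℝ} (h : IsHodgeDual (k := 3) (l := 4) g vol ψ Ψ)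
    (hψ : ψ ∈ Submodule.span ℝ (Set.range wedgeOneForms)) {v : Fin 6 → V} {w : Fin 7 → V}
    (hvw : ∀ i j, g (v i) (w j) = if j = i.succ then 1 else 0) (τ : Equiv.Perm (Fin 6)) :
    Ψ (fun r => v (τ r.succ.succ)) * vol w =
      ((τ.sign : ℤ) : ℝ) * ψ ![w 0, w (τ 0).succ, w (τ 1).succ] := by
  let σ : Equiv.Perm (Fin 7) := Equiv.Perm.decomposeFin.symm (0, τ)
  have hσ (i : Fin 6) : σ i.succ = (τ i).succ := by simp [σ]
  have h_dual (a : Fin 4) (c : Fin 7) :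
      g (v (τ a.succ.succ)) (w (σ c)) = if c = a.succ.succ.succ then 1 else 0 := by
    rw [hvw, ← hσ]
    exact if_congr σ.injective.eq_iff rfl rfl
  have h_apply := h.apply_mul_vol hψ (fun r => v (τ r.succ.succ)) (w ∘ σ)
    (fun a b => (h_dual a _).trans (if_neg fun h => by
      have h_val := congrArg Fin.val h
      simp only [Fin.val_castAdd, Fin.val_succ] at h_val
      lia))
    (fun a b => (h_dual a _).trans (if_congr (by
      simp only [Fin.ext_iff, Fin.val_natAdd, Fin.val_succ]
      lia) rfl rfl))
  have h_args : (fun b : Fin 3 => (w ∘ σ) (Fin.castAdd 4 b)) =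
      ![w 0, w (τ 0).succ, w (τ 1).succ] := by
    ext b
    fin_cases b
    exacts [congrArg w (by simp [σ]), congrArg w (hσ 0), congrArg w (hσ 1)]
  have h_perm : vol (w ∘ σ) = ((τ.sign : ℤ) : ℝ) * vol w := by
    rw [vol.map_perm, Units.smul_def, zsmul_eq_mul]
    simp [σ]
  have h_sign : ((τ.sign : ℤ) : ℝ) * ((τ.sign : ℤ) : ℝ) = 1 := by
    exact_mod_cast Int.units_coe_mul_self τ.sign
  rw [← h_args, ← h_apply]
  refine Eq.trans ?_ (congrArg (fun c => _ * (_ * c)) h_perm.symm)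
  linear_combination -(Ψ (fun r => v (τ r.succ.succ)) * vol w) * h_sign

theorem IsHodgeDual.isClosedForm_iff_rescalesByTrace [IsLieAbelian I] (hθ : θ x₀ = 1)
    (h_ker : LinearMap.ker θ = I.toSubmodule)
    {g : LinearMap.BilinForm ℝ L} {vol : L [⋀^Fin 7]→ₗ[ℝ] ℝ} {ψ : L [⋀^Fin 3]→ₗ[ℝ] ℝ}
    {Ψ : L [⋀^Fin 4]→ₗ[ℝ] ℝ} (h : IsHodgeDual (k := 3) (l := 4) g vol ψ Ψ)
    (hψ : ψ ∈ Submodule.span ℝ (Set.range wedgeOneForms)) (v : Module.Basis (Fin 6) ℝ I)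
    {w : Fin 7 → L} (h_vol : vol w ≠ 0)
    (hvw : ∀ i j, g (v i) (w j) = if j = i.succ then 1 else 0) {B : Matrix (Fin 6) (Fin 6) ℝ}
    (hB : B.transpose = -B) (hw : ∀ i j : Fin 6, ψ ![w 0, w i.succ, w j.succ] = B i j) :
    IsClosedForm (k := 3) Ψ ↔
      RescalesByTrace (LinearMap.toMatrix v v (LieModule.toEnd ℝ L I x₀)) B := by
  have h_bivector : (2 : ℝ) • vol w • Ψ.compLinearMap I.toSubmodule.subtype =
      contractBivector (n := 4) v B := two_smul_eq_contractBivector hB fun τ => by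
    rw [← hw, ← h.apply_perm_mul_vol hψ hvw τ, mul_comm]
    rfl
  rw [isClosedForm_iff_formDerivation_restrict_eq_zero hθ h_ker v,
    ← formDerivation_contractBivector_eq_zero_iff v hB, ← h_bivector, map_smul, map_smul,
    smul_eq_zero_iff_right two_ne_zero, smul_eq_zero_iff_right h_vol]

end CodimensionOneIdeal

section Normals

theorem nondegenerate_restrict_ker_iff {K V : Type*} [Field K] [AddCommGroup V] [Module K V]
    {B : LinearMap.BilinForm K V} (h_symm : B.IsSymm) (hB : B.Nondegenerate) {n : V}
    (hn : n ≠ 0) : (B.restrict (LinearMap.ker (B n))).Nondegenerate ↔ B n n ≠ 0 := by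
  refine ⟨fun h h_null => hn ?_, fun h => ?_⟩
  · exact congrArg Subtype.val (h.1 ⟨n, h_null⟩ fun y => y.2)
  · have h_perp : B.orthogonal (K ∙ n) = LinearMap.ker (B n) :=
      LinearMap.BilinForm.orthogonal_span_singleton_eq_toLin_ker n
    rw [← h_perp]
    exact LinearMap.BilinForm.restrict_nondegenerate_orthogonal_spanSingleton B hB h_symm.isRefl h

theorem exists_basis_ker_dual_to_tail {K V : Type*} [Field K] [AddCommGroup V] [Module K V]
    {B : LinearMap.BilinForm K V} (h_symm : B.IsSymm) (hB : B.Nondegenerate) {W : Submodule K V}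
    {m : ℕ} (w : Module.Basis (Fin (m + 1)) K V) (hW : LinearMap.ker (B (w 0)) = W) :
    ∃ v : Module.Basis (Fin m) K W, ∀ i j, B (v i) (w j) = if j = i.succ then 1 else 0 := by
  subst hW
  have : FiniteDimensional K V := Module.Finite.of_basis w
  let u := B.dualBasis hB w
  have hu (i : Fin m) (j : Fin (m + 1)) : B (u i.succ) (w j) = if j = i.succ then 1 else 0 :=
    B.apply_dualBasis_left hB w i.succ j
  let v (i : Fin m) : LinearMap.ker (B (w 0)) :=
    ⟨u i.succ, (h_symm.eq _ _).trans ((hu i 0).trans (if_neg (Fin.succ_ne_zero i).symm))⟩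
  have h_indep : LinearIndependent K v :=
    .of_comp (LinearMap.ker (B (w 0))).subtype
      (u.linearIndependent.comp _ (Fin.succ_injective m))
  have h_card : Fintype.card (Fin m) = Module.finrank K (LinearMap.ker (B (w 0))) := by
    have h_rank := Module.Dual.finrank_ker_add_one_of_ne_zero (f := B (w 0)) fun h =>
      w.ne_zero 0 (hB.1 _ fun y => LinearMap.congr_fun h y)
    rw [Module.finrank_eq_card_basis w, Fintype.card_fin] at h_rank
    rw [Fintype.card_fin]
    lia
  refine ⟨.mk h_indep (h_indep.span_eq_top_of_card_eq_finrank' h_card).ge, fun i j => ?_⟩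
  rw [Module.Basis.mk_apply]
  exact hu i j

end Normals

section CocalibratedBases

theorem modelForm_map {V V' : Type*} [AddCommGroup V] [Module ℝ V] [AddCommGroup V'] [Module ℝ V']
    (δ : ℤˣ) (e : Module.Basis (Fin 7) ℝ V) (T : V ≃ₗ[ℝ] V') (x y z : V) :
    modelForm δ (e.map T) ![T x, T y, T z] = modelForm δ e ![x, y, z] := by
  simp [modelForm_apply, Matrix.det_fin_three]

theorem modelMetric_map {V V' : Type*} [AddCommGroup V] [Module ℝ V] [AddCommGroup V']
    [Module ℝ V'] (δ : ℤˣ) (e : Module.Basis (Fin 7) ℝ V) (T : V ≃ₗ[ℝ] V') (x y : V) :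
    modelMetric δ (e.map T) (T x) (T y) = modelMetric δ e x y := by
  simp [modelMetric_apply]

theorem modelMetric_one_self_ne_zero {V : Type*} [AddCommGroup V] [Module ℝ V]
    (e : Module.Basis (Fin 7) ℝ V) {x : V} (hx : x ≠ 0) : modelMetric 1 e x x ≠ 0 := by
  have h_sign : ∀ i, metricSign 1 i = 1 := by decide
  contrapose! hx
  simp only [modelMetric_apply, h_sign, Int.cast_one, one_mul] at hx
  rw [Finset.sum_eq_zero_iff_of_nonneg fun i _ => mul_self_nonneg _] at hx
  exact e.repr.map_eq_zero_iff.1 (Finsupp.ext fun i => by simpa using hx i (Finset.mem_univ i))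

variable {L : Type*} [LieRing L] [LieAlgebra ℝ L] {δ : ℤˣ} {e : Module.Basis (Fin 7) ℝ L}

variable (δ e) in
/-- The standard three-form of the basis `e` is cocalibrated, as a `G₂`-structure for `δ = 1` and
as a `G₂*`-structure for `δ = -1`. -/
def IsCocalibratedBasis : Prop :=
  ∃ Ψ : L [⋀^Fin 4]→ₗ[ℝ] ℝ,
    IsHodgeDual (k := 3) (l := 4) (modelMetric δ e) (basisVol e) (modelForm δ e) Ψ ∧
      IsClosedForm (k := 3) Ψ

theorem isCocalibratedG2_iff {φ : L [⋀^Fin 3]→ₗ[ℝ] ℝ} :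
    IsCocalibratedG2 φ ↔ ∃ e : Module.Basis (Fin 7) ℝ L,
      φ = modelForm 1 e ∧ IsCocalibratedBasis 1 e := by
  simp only [IsCocalibratedG2, IsG2Structure, isInducedByG2_iff, ← modelForm_one]
  constructor
  · rintro ⟨⟨e, rfl⟩, g, vol, Ψ, h_induced, hΨ⟩
    obtain ⟨rfl, rfl⟩ := isInduced_modelForm_iff.1 h_induced
    exact ⟨e, rfl, Ψ, hΨ⟩
  · rintro ⟨e, rfl, Ψ, hΨ⟩
    exact ⟨⟨e, rfl⟩, _, _, Ψ, isInduced_modelForm_iff.2 ⟨rfl, rfl⟩, hΨ⟩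

theorem isCocalibratedG2Star_iff {φ : L [⋀^Fin 3]→ₗ[ℝ] ℝ} :
    IsCocalibratedG2Star φ ↔ ∃ e : Module.Basis (Fin 7) ℝ L,
      φ = modelForm (-1) e ∧ IsCocalibratedBasis (-1) e := by
  simp only [IsCocalibratedG2Star, IsG2StarStructure, isInducedByG2Star_iff, ← modelForm_neg_one]
  constructor
  · rintro ⟨⟨e, rfl⟩, g, vol, Ψ, h_induced, hΨ⟩
    obtain ⟨rfl, rfl⟩ := isInduced_modelForm_iff.1 h_induced
    exact ⟨e, rfl, Ψ, hΨ⟩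
  · rintro ⟨e, rfl, Ψ, hΨ⟩
    exact ⟨⟨e, rfl⟩, _, _, Ψ, isInduced_modelForm_iff.2 ⟨rfl, rfl⟩, hΨ⟩

theorem isNondegenerateForG2Star_modelForm_iff {V : Type*} [AddCommGroup V] [Module ℝ V]
    {e : Module.Basis (Fin 7) ℝ V} {U : Submodule ℝ V} :
    IsNondegenerateForG2Star (modelForm (-1) e) U ↔
      ((modelMetric (-1) e).restrict U).Nondegenerate := by
  simp only [IsNondegenerateForG2Star, isInducedByG2Star_iff, isInduced_modelForm_iff]
  exact ⟨fun ⟨_, _, ⟨h_metric, _⟩, h⟩ => h_metric ▸ h, fun h => ⟨_, _, ⟨rfl, rfl⟩, h⟩⟩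

variable {I : LieIdeal ℝ L} [IsLieAbelian I] {θ : Module.Dual ℝ L} {x₀ : L}

theorem isCocalibratedBasis_iff_rescalesByTrace (hθ : θ x₀ = 1)
    (h_ker : LinearMap.ker θ = I.toSubmodule) (v : Module.Basis (Fin 6) ℝ I)
    (w : Module.Basis (Fin 7) ℝ L)
    (hvw : ∀ i j, modelMetric δ e (v i) (w j) = if j = i.succ then 1 else 0) {k : ℕ}
    (hw : ∀ i j : Fin 6, modelForm δ e ![w 0, w i.succ, w j.succ] = standardSkew k i j) :
    IsCocalibratedBasis δ e ↔ RescalesByTrace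
      (LinearMap.toMatrix v v (LieModule.toEnd ℝ L I x₀)) (skewMatrix ℝ 6 k) := by
  have h_vol : basisVol e w ≠ 0 := by
    rw [basisVol_apply_basis, ← e.det_apply]
    exact (e.isUnit_det w).ne_zero
  have h_iff {Ψ} (hΨ : IsHodgeDual (k := 3) (l := 4) (modelMetric δ e) (basisVol e)
      (modelForm δ e) Ψ) := hΨ.isClosedForm_iff_rescalesByTrace hθ h_ker (modelForm_mem_span δ e)
    v h_vol hvw (B := skewMatrix ℝ 6 k) (transpose_skewMatrix ℝ 6 k) hw
  obtain ⟨Ψ, hΨ⟩ := exists_isHodgeDual_modelForm δ e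
  exact ⟨fun ⟨_, hΨ', h⟩ => (h_iff hΨ').1 h, fun h => ⟨Ψ, hΨ, (h_iff hΨ).2 h⟩⟩

theorem IsCocalibratedBasis.exists_rescalesByTrace (hθ : θ x₀ = 1)
    (h_ker : LinearMap.ker θ = I.toSubmodule) (he : IsCocalibratedBasis δ e) {n : L}
    (hn : modelMetric δ e n = θ) :
    ∃ v : Module.Basis (Fin 6) ℝ I, RescalesByTrace
      (LinearMap.toMatrix v v (LieModule.toEnd ℝ L I x₀))
      (skewMatrix ℝ 6 (interiorHalfRank (modelMetric δ e n n))) := by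
  have hn_ne : n ≠ 0 := by
    rintro rfl
    simp [← hn] at hθ
  obtain ⟨w, rfl, hw⟩ := exists_basis_modelForm_eq_standardSkew δ e hn_ne
  obtain ⟨v, hvw⟩ := exists_basis_ker_dual_to_tail (modelMetric_isSymm δ e)
    (modelMetric_nondegenerate δ e) w (hn ▸ h_ker)
  exact ⟨v, (isCocalibratedBasis_iff_rescalesByTrace hθ h_ker v w hvw hw).1 he⟩

/-- A basis of the model space dual to one in which `n₀ ⌟ φ` is in normal form is carried to the
basis `x₀, v` of the Lie algebra. -/
theorem exists_isCocalibratedBasis_of_rescalesByTrace (hθ : θ x₀ = 1)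
    (h_ker : LinearMap.ker θ = I.toSubmodule) {V : Type*} [AddCommGroup V] [Module ℝ V]
    (e₀ : Module.Basis (Fin 7) ℝ V) {n₀ : V} (hn₀ : n₀ ≠ 0) {v : Module.Basis (Fin 6) ℝ I}
    (hv : RescalesByTrace (LinearMap.toMatrix v v (LieModule.toEnd ℝ L I x₀))
      (skewMatrix ℝ 6 (interiorHalfRank (modelMetric δ e₀ n₀ n₀)))) :
    ∃ (e : Module.Basis (Fin 7) ℝ L) (n : L), IsCocalibratedBasis δ e ∧
      modelMetric δ e n = θ ∧ modelMetric δ e n n = modelMetric δ e₀ n₀ n₀ := by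
  have : FiniteDimensional ℝ V := Module.Finite.of_basis e₀
  obtain ⟨w, rfl, hw⟩ := exists_basis_modelForm_eq_standardSkew δ e₀ hn₀
  obtain ⟨b, hb_zero, hb_succ⟩ := exists_basis_cons_eq hθ h_ker v
  let u := (modelMetric δ e₀).dualBasis (modelMetric_nondegenerate δ e₀) w
  let T : V ≃ₗ[ℝ] L := u.equiv b (Equiv.refl _)
  have hT (i : Fin 7) : T (u i) = b i := u.equiv_apply ..
  have h_dual (i j : Fin 7) :
      modelMetric δ (e₀.map T) (b i) (T (w j)) = if j = i then 1 else 0 := by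
    rw [← hT, modelMetric_map]
    exact LinearMap.BilinForm.apply_dualBasis_left _ w i j
  refine ⟨e₀.map T, T (w 0), ?_, b.ext fun i => ?_, modelMetric_map δ e₀ T _ _⟩
  · refine (isCocalibratedBasis_iff_rescalesByTrace hθ h_ker v (w.map T) (fun i j => ?_)
      fun i j => ?_).2 hv
    · rw [← hb_succ, w.map_apply, h_dual]
    · simp only [w.map_apply, modelForm_map, hw]
  · rw [(modelMetric_isSymm δ _).eq, h_dual]
    refine Fin.cases ?_ (fun i => ?_) i
    · rw [hb_zero, hθ, if_pos rfl]
    · have h_mem : (v i : L) ∈ LinearMap.ker θ := h_ker ▸ (v i).2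
      rw [hb_succ, h_mem, if_neg (Fin.succ_ne_zero i).symm]

theorem exists_isCocalibratedBasis_nonnull_iff (δ : ℤˣ) (hθ : θ x₀ = 1)
    (h_ker : LinearMap.ker θ = I.toSubmodule) :
    (∃ (e : Module.Basis (Fin 7) ℝ L) (n : L), IsCocalibratedBasis δ e ∧
        modelMetric δ e n = θ ∧ modelMetric δ e n n ≠ 0) ↔
      ∃ v : Module.Basis (Fin 6) ℝ I, RescalesByTrace
        (LinearMap.toMatrix v v (LieModule.toEnd ℝ L I x₀)) (skewMatrix ℝ 6 3) := by
  constructor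
  · rintro ⟨e, n, he, hn, h_nonnull⟩
    have h := he.exists_rescalesByTrace hθ h_ker hn
    rwa [interiorHalfRank, if_neg h_nonnull] at h
  · rintro ⟨v, hv⟩
    let e₀ := Pi.basisFun ℝ (Fin 7)
    have h_square : modelMetric δ e₀ (e₀ 6) (e₀ 6) ≠ 0 := by
      simp [modelMetric_apply_basis, metricSign]
    obtain ⟨e, n, he, hn, h_eq⟩ := exists_isCocalibratedBasis_of_rescalesByTrace (δ := δ) hθ h_ker
      e₀ (e₀.ne_zero 6) (v := v) (by rwa [interiorHalfRank, if_neg h_square])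
    exact ⟨e, n, he, hn, h_eq ▸ h_square⟩

theorem exists_isCocalibratedBasis_null_iff (hθ : θ x₀ = 1)
    (h_ker : LinearMap.ker θ = I.toSubmodule) :
    (∃ (e : Module.Basis (Fin 7) ℝ L) (n : L), IsCocalibratedBasis (-1) e ∧
        modelMetric (-1) e n = θ ∧ modelMetric (-1) e n n = 0) ↔
      ∃ v : Module.Basis (Fin 6) ℝ I, RescalesByTrace
        (LinearMap.toMatrix v v (LieModule.toEnd ℝ L I x₀)) (skewMatrix ℝ 6 2) := by
  constructor
  · rintro ⟨e, n, he, hn, h_null⟩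
    have h := he.exists_rescalesByTrace hθ h_ker hn
    rwa [interiorHalfRank, if_pos h_null] at h
  · rintro ⟨v, hv⟩
    let e₀ := Pi.basisFun ℝ (Fin 7)
    have h_square : modelMetric (-1) e₀ (e₀ 0 + e₀ 4) (e₀ 0 + e₀ 4) = 0 := by
      simp [modelMetric_apply_basis, metricSign]
    have h_ne : e₀ 0 + e₀ 4 ≠ 0 := fun h => by simpa [e₀] using congrFun h 0
    obtain ⟨e, n, he, hn, h_eq⟩ := exists_isCocalibratedBasis_of_rescalesByTrace (δ := -1) hθ h_ker
      e₀ h_ne (v := v) (by rwa [interiorHalfRank, if_pos h_square])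
    exact ⟨e, n, he, hn, h_eq.trans h_square⟩

theorem exists_modelMetric_eq (δ : ℤˣ) (e : Module.Basis (Fin 7) ℝ L) (θ : Module.Dual ℝ L) :
    ∃ n, modelMetric δ e n = θ := by
  have : FiniteDimensional ℝ L := Module.Finite.of_basis e
  exact ((modelMetric δ e).toDual (modelMetric_nondegenerate δ e)).surjective θ

theorem exists_isCocalibratedG2_iff (hθ : θ x₀ = 1) (h_ker : LinearMap.ker θ = I.toSubmodule) :
    (∃ φ : L [⋀^Fin 3]→ₗ[ℝ] ℝ, IsCocalibratedG2 φ) ↔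
      ∃ v : Module.Basis (Fin 6) ℝ I, RescalesByTrace
        (LinearMap.toMatrix v v (LieModule.toEnd ℝ L I x₀)) (skewMatrix ℝ 6 3) := by
  simp only [isCocalibratedG2_iff, ← exists_isCocalibratedBasis_nonnull_iff 1 hθ h_ker]
  constructor
  · rintro ⟨-, e, rfl, he⟩
    obtain ⟨n, rfl⟩ := exists_modelMetric_eq 1 e θ
    refine ⟨e, n, he, rfl, modelMetric_one_self_ne_zero e ?_⟩
    rintro rfl
    simp at hθ
  · rintro ⟨e, -, he, -⟩
    exact ⟨_, e, rfl, he⟩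

theorem exists_isCocalibratedG2Star_nondegenerate_iff (hθ : θ x₀ = 1)
    (h_ker : LinearMap.ker θ = I.toSubmodule) :
    (∃ φ : L [⋀^Fin 3]→ₗ[ℝ] ℝ, IsCocalibratedG2Star φ ∧
        IsNondegenerateForG2Star φ I.toSubmodule) ↔
      ∃ v : Module.Basis (Fin 6) ℝ I, RescalesByTrace
        (LinearMap.toMatrix v v (LieModule.toEnd ℝ L I x₀)) (skewMatrix ℝ 6 3) := by
  have h_iff {e : Module.Basis (Fin 7) ℝ L} {n : L} (hn : modelMetric (-1) e n = θ) :
      IsNondegenerateForG2Star (modelForm (-1) e) I.toSubmodule ↔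
        modelMetric (-1) e n n ≠ 0 := by
    subst hn
    rw [isNondegenerateForG2Star_modelForm_iff, ← h_ker]
    refine nondegenerate_restrict_ker_iff (modelMetric_isSymm _ e)
      (modelMetric_nondegenerate _ e) ?_
    rintro rfl
    simp at hθ
  simp only [isCocalibratedG2Star_iff, ← exists_isCocalibratedBasis_nonnull_iff (-1) hθ h_ker]
  constructor
  · rintro ⟨-, ⟨e, rfl, he⟩, h_nondeg⟩
    obtain ⟨n, hn⟩ := exists_modelMetric_eq (-1) e θ
    exact ⟨e, n, he, hn, (h_iff hn).1 h_nondeg⟩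
  · rintro ⟨e, n, he, hn, h_nonnull⟩
    exact ⟨_, ⟨e, rfl, he⟩, (h_iff hn).2 h_nonnull⟩

theorem exists_isCocalibratedG2Star_iff (hθ : θ x₀ = 1)
    (h_ker : LinearMap.ker θ = I.toSubmodule) :
    (∃ φ : L [⋀^Fin 3]→ₗ[ℝ] ℝ, IsCocalibratedG2Star φ) ↔
      (∃ v : Module.Basis (Fin 6) ℝ I, RescalesByTrace
        (LinearMap.toMatrix v v (LieModule.toEnd ℝ L I x₀)) (skewMatrix ℝ 6 3)) ∨
      ∃ v : Module.Basis (Fin 6) ℝ I, RescalesByTrace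
        (LinearMap.toMatrix v v (LieModule.toEnd ℝ L I x₀)) (skewMatrix ℝ 6 2) := by
  simp only [isCocalibratedG2Star_iff, ← exists_isCocalibratedBasis_null_iff hθ h_ker,
    ← exists_isCocalibratedBasis_nonnull_iff (-1) hθ h_ker]
  constructor
  · rintro ⟨-, e, rfl, he⟩
    obtain ⟨n, hn⟩ := exists_modelMetric_eq (-1) e θ
    rcases eq_or_ne (modelMetric (-1) e n n) 0 with h_null | h_nonnull
    exacts [.inr ⟨e, n, he, hn, h_null⟩, .inl ⟨e, n, he, hn, h_nonnull⟩]
  · rintro (⟨e, -, he, -⟩ | ⟨e, -, he, -⟩) <;> exact ⟨_, e, rfl, he⟩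

end CocalibratedBases
theorem mainTheorem5 {𝔤 : Type*} [LieRing 𝔤] [LieAlgebra ℝ 𝔤]
    (h𝔤 : Module.finrank ℝ 𝔤 = 7)
    (𝔲 : LieIdeal ℝ 𝔤) (h𝔲 : Module.finrank ℝ 𝔲 = 6) (h𝔲_abelian : IsLieAbelian 𝔲)
    (e₇ : 𝔤) (he₇ : e₇ ∉ 𝔲)
    (ω₆ : LinearMap.BilinForm ℝ 𝔲) (hω₆_alt : ω₆.IsAlt) (hω₆ : ω₆.Nondegenerate)
    (V₄ V₂ : Submodule ℝ 𝔲) (hV₄ : Module.finrank ℝ V₄ = 4) (hV₂ : Module.finrank ℝ V₂ = 2)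
    (hV : IsCompl V₂ V₄)
    (ω₄ : LinearMap.BilinForm ℝ V₄) (hω₄_alt : ω₄.IsAlt) (hω₄ : ω₄.Nondegenerate) :
    (((∃ φ : 𝔤 [⋀^Fin 3]→ₗ[ℝ] ℝ, IsCocalibratedG2 φ) ↔
        (∃ φ : 𝔤 [⋀^Fin 3]→ₗ[ℝ] ℝ, IsCocalibratedG2Star φ ∧
          IsNondegenerateForG2Star φ 𝔲.toSubmodule)) ∧
      ((∃ φ : 𝔤 [⋀^Fin 3]→ₗ[ℝ] ℝ, IsCocalibratedG2 φ) ↔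
        IsSimilarToElementOf (LieModule.toEnd ℝ 𝔤 𝔲 e₇) (symplecticAlgebra ω₆))) ∧
    ((∃ φ : 𝔤 [⋀^Fin 3]→ₗ[ℝ] ℝ, IsCocalibratedG2Star φ) ↔
      (IsSimilarToElementOf (LieModule.toEnd ℝ 𝔤 𝔲 e₇) (symplecticAlgebra ω₆) ∨
        IsSimilarToElementOf (LieModule.toEnd ℝ 𝔤 𝔲 e₇) (lengthTwoStabilizer V₂ V₄ ω₄))) := by
  have : FiniteDimensional ℝ 𝔤 := Module.finite_of_finrank_eq_succ h𝔤
  obtain ⟨θ, hθ, h_ker⟩ := exists_dual_apply_eq_one_and_ker (W := 𝔲.toSubmodule) (x := e₇)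
    (h𝔤 ▸ congrArg (· + 1) h𝔲) he₇
  rw [isSimilarToElementOf_symplecticAlgebra_iff (k := 3) (by decide) h𝔲 hω₆_alt hω₆,
    isSimilarToElementOf_lengthTwoStabilizer_iff hV₄ hV₂ hV hω₄_alt hω₄,
    exists_isCocalibratedG2_iff hθ h_ker, exists_isCocalibratedG2Star_nondegenerate_iff hθ h_ker,
    exists_isCocalibratedG2Star_iff hθ h_ker]
  exact ⟨⟨Iff.rfl, Iff.rfl⟩, Iff.rfl⟩
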